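/- Let $g(x,x')=\sum_{n\ge 0}P_x[X_n=x']$, $x,x'\in\mathbb Z^3$, be the Green function of simple random walk on $\mathbb Z^3$ (a convergent series), and let $a(y)=\lim_{n\to\infty}\sum_{j=0}^n\bigl(P_0[X_j=0]-P_0[X_j=y]\bigr)$, $y\in\mathbb Z^2$, be the potential kernel of simple random walk on $\mathbb Z^2$ (the limit exists). Write $Gf(x)=\sum_{x'\in\mathbb Z^3}g(x,x')f(x')$ and $(f,h)=\sum_{x\in\mathbb Z^3}f(x)h(x)$. Let $\Lambda\subset\mathbb Z^2$ be a finite set containing $0$, and let $W:\mathbb Z^2\to\mathbb R$ vanish outside $\Lambda$ and satisfy $\sum_y W(y)=0$. For $\alpha>0$ and integers $N>1$, $n\ge 1$, set $$u_N=\alpha\,\frac{\log N}{N},\qquad V_N(y,z)=\frac{W(y)}{\sqrt{\log N}}\,1_{\{1\le z\le N\}}\quad (y\in\mathbb Z^2,\ z\in\mathbb Z),\qquad a_N(n)=u_N\,\bigl(V_N,(GV_N)^{n-1}1\bigr),$$ where $GV_N$ is the composition of $G$ with multiplication by $V_N$ and $1$ is the constant function. Set $$\mathcal E(W)=-3\sum_{y,y'}W(y)W(y')\,a(y'-y).$$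 Theorem. There is a constant $c_0>0$ depending only on $\Lambda$ and $W$ such that, for every $\alpha>0$, (i) $|a_N(n)|\le \alpha c_0^n$ for all $n\ge 1$ and $N>1$; (ii) $\lim_{N\to\infty} a_N(2k+1)=0$ for every $k\ge 0$; (iii) $\lim_{N\to\infty} a_N(2k)=\dfrac{\alpha}{2}\,\mathcal E(W)\Bigl(\dfrac{3}{2\pi}\,\mathcal E(W)\Bigr)^{k-1}$ for every $k\ge 1$. -/

import Mathlib

open Filter Topology

noncomputable section

/-- `walkProb S n x y` is `P_x[X_n = y]` for the random walk on the additive group `A` started at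
`x` whose increments are i.i.d. and uniformly distributed on the finite set `S`. -/
def walkProb {A : Type} [AddCommGroup A] [DecidableEq A] (S : Finset A) : ℕ → A → A → ℝ
  | 0, x, y => if x = y then 1 else 0
  | n + 1, x, y => (∑ s ∈ S, walkProb S n x (y - s)) / (S.card : ℝ)

/-- The steps of the simple random walk on `ℤ²`. -/
def steps2 : Finset (ℤ × ℤ) := {(1, 0), (-1, 0), (0, 1), (0, -1)}

/-- The steps of the simple random walk on `ℤ³`, written as `ℤ² × ℤ`. -/
def steps3 : Finset ((ℤ × ℤ) × ℤ) :=
  {((1, 0), 0), ((-1, 0), 0), ((0, 1), 0), ((0, -1), 0), ((0, 0), 1), ((0, 0), -1)}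

/-- The Green function `g(x, x') = ∑_{n ≥ 0} P_x[X_n = x']` of the simple random walk on `ℤ³`. -/
def green (x x' : (ℤ × ℤ) × ℤ) : ℝ := ∑' n : ℕ, walkProb steps3 n x x'

/-- The partial sum `∑_{j=0}^n (P_0[X_j = 0] - P_0[X_j = y])` for the simple random walk on `ℤ²`. -/
def potentialSum (y : ℤ × ℤ) (n : ℕ) : ℝ :=
  ∑ j ∈ Finset.range (n + 1), (walkProb steps2 j 0 0 - walkProb steps2 j 0 y)

/-- The potential kernel `a(y)` of the simple random walk on `ℤ²`. -/
def potentialKernel (y : ℤ × ℤ) : ℝ := limUnder atTop (potentialSum y)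

/-- The operator `G f(x) = ∑_{x'} g(x, x') f(x')`. -/
def greenOp (f : (ℤ × ℤ) × ℤ → ℝ) (x : (ℤ × ℤ) × ℤ) : ℝ := ∑' x', green x x' * f x'

/-- The scalar product `(f, h) = ∑_x f(x) h(x)` of functions on `ℤ³`. -/
def pairing (f h : (ℤ × ℤ) × ℤ → ℝ) : ℝ := ∑' x, f x * h x

/-- The level `u_N = α log N / N`. -/
def level (α : ℝ) (N : ℕ) : ℝ := α * (Real.log N / N)

/-- The function `V_N(y, z) = W(y) 1_{1 ≤ z ≤ N} / √(log N)` on `ℤ³`. -/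
def rodPotential (W : ℤ × ℤ → ℝ) (N : ℕ) (x : (ℤ × ℤ) × ℤ) : ℝ :=
  if 1 ≤ x.2 ∧ x.2 ≤ (N : ℤ) then W x.1 / √(Real.log N) else 0

/-- The coefficient `a_N(n) = u_N (V_N, (G V_N)^{n-1} 1)`, for `n ≥ 1`, where `V_N` acts by
multiplication and `1` is the constant function. -/
def coeffA (α : ℝ) (W : ℤ × ℤ → ℝ) (N n : ℕ) : ℝ :=
  level α N * pairing (rodPotential W N)
    ((fun F : (ℤ × ℤ) × ℤ → ℝ => greenOp (fun x => rodPotential W N x * F x))^[n - 1]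
      (fun _ => 1))

/-- `𝓔(W) = -3 ∑_{y,y'} W(y) W(y') a(y' - y)`, for `W` vanishing outside the finite set `Λ`. -/
def energy (Λ : Finset (ℤ × ℤ)) (W : ℤ × ℤ → ℝ) : ℝ :=
  -3 * ∑ y ∈ Λ, ∑ y' ∈ Λ, W y * W y' * potentialKernel (y' - y)

end

/-! Run the walk on ℤ³ in continuous time at rate 3: its coordinates become independent rate-one
walks on ℤ with transition function `heatKernel`, written p_t below, so that g(x, x') = 3 ∫ p_t(k)
p_t(l) p_t(z) dt for the displacement ((k, l), z). Splitting off the value on the vertical axis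
gives g = A(z) - D_u(z), with A = `axisGreen`, D = `greenDefect` and u the horizontal displacement
(`green_eq`). Both kernels are even and nonnegative.

Two facts about vertical sums carry the limit. The sum of A over [-m, m] is asymptotic to (3/π) log
m (`tendsto_windowSum_axisGreen_div_log`), because p_t(0)² ~ 1/(2πt) and the vertical walk stays in
the window until time about m². The sum of D_u over ℤ is (3/2) a(u) (`hasSum_greenDefect`), because
summing out the vertical coordinate leaves the planar walk.

Let F_n = (G V_N)^n 1 and q_n(z) = √(log N) ∑_y W(y) F_n(y, z). Since ∑ W = 0, A drops out of
q_{n+1}, and the remaining factors √(log N) and 1/√(log N) cancel (`rodCharge_succ`). In F_{n+1} the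
A-part is A * q_n / log N, while the D-part is of order 1/√(log N) (`rodIterate_succ`). Hence F_n
and q_n tend to constants φ_n and χ_n with φ_{n+1} = (3/π) χ_n, χ_{n+1} = (𝓔/2) φ_n, φ_0 = 1 and χ_0
= 0. As a_N(n+1) is α times the average of q_n over the rod (`coeffA_succ`), the limits follow. The
same recursion gives the geometric bound.

The convergence cannot be uniform on the rod, since near its ends only about half of the mass of A
is seen. The right notion is convergence in L¹ average, `MeanTendsto`, which convolution with either
kernel, suitably normalized, preserves. -/

section WalkFourier

open MeasureTheory

/-! ### Spectral representation of walk probabilities -/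

variable {A Ω : Type} [AddCommGroup A] [DecidableEq A] [MeasurableSpace Ω]

theorem hasSum_of_forall_eq {ι : Type} {f g : ι → ℝ} {a : ℝ} (h : HasSum f a)
    (e : ∀ i, f i = g i) : HasSum g a :=
  (funext e : f = g) ▸ h

theorem walkProb_nonneg (S : Finset A) (n : ℕ) (x y : A) : 0 ≤ walkProb S n x y := by
  induction n generalizing y with
  | zero => simp only [walkProb]; split_ifs <;> norm_num
  | succ n ih => exact div_nonneg (Finset.sum_nonneg fun s _ => ih _) (by positivity)

/-- A family of bounded real functions `c a`, `a ∈ A`, on a probability space that behaves like the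
even part of the characters of `A` with respect to the step set `S`, with symbol `φ`. -/
structure SpectralFamily (S : Finset A) (μ : Measure Ω) (φ : Ω → ℝ) (c : A → Ω → ℝ) : Prop where
  nonempty : S.Nonempty
  measurable_symbol : Measurable φ
  abs_symbol_le : ∀ ω, |φ ω| ≤ 1
  measurable : ∀ a, Measurable (c a)
  abs_le : ∀ a ω, |c a ω| ≤ 1
  integral_eq : ∀ a, ∫ ω, c a ω ∂μ = if a = 0 then 1 else 0
  sum_eq : ∀ a ω, ∑ s ∈ S, c (a - s) ω = S.card * (φ ω * c a ω)

namespace SpectralFamily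

variable {S : Finset A} {μ : Measure Ω} [IsProbabilityMeasure μ] {φ : Ω → ℝ} {c : A → Ω → ℝ}

theorem integrable_pow_mul (h : SpectralFamily S μ φ c) (n : ℕ) (a : A) :
    Integrable (fun ω => φ ω ^ n * c a ω) μ := by
  refine Integrable.of_bound
    ((h.measurable_symbol.pow_const n).mul (h.measurable a)).aestronglyMeasurable 1
    (ae_of_all _ fun ω => ?_)
  rw [Real.norm_eq_abs, abs_mul, abs_pow]
  exact mul_le_one₀ (pow_le_one₀ (abs_nonneg _) (h.abs_symbol_le ω)) (abs_nonneg _) (h.abs_le a ω)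

theorem walkProb_eq (h : SpectralFamily S μ φ c) (n : ℕ) (x y : A) :
    walkProb S n x y = ∫ ω, φ ω ^ n * c (y - x) ω ∂μ := by
  induction n generalizing y with
  | zero => simp [walkProb, h.integral_eq, sub_eq_zero, eq_comm]
  | succ n ih =>
    have hS : (S.card : ℝ) ≠ 0 := by exact_mod_cast h.nonempty.card_ne_zero
    simp only [walkProb, ih]
    rw [← integral_finsetSum _ fun s _ => h.integrable_pow_mul n _, div_eq_iff hS,
      ← integral_mul_const]
    refine integral_congr_ae (ae_of_all _ fun ω => ?_)
    have := h.sum_eq (y - x) ω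
    simp only [← Finset.mul_sum, sub_right_comm y _ x, this]
    ring

/-- The transition function of the walk in continuous time with unit jump rate. -/
theorem hasSum_poisson (h : SpectralFamily S μ φ c) {t : ℝ} (ht : 0 ≤ t) (x y : A) :
    HasSum (fun n : ℕ => Real.exp (-t) * (t ^ n / n.factorial) * walkProb S n x y)
      (∫ ω, Real.exp (-t * (1 - φ ω)) * c (y - x) ω ∂μ) := by
  simp only [h.walkProb_eq, ← integral_const_mul]
  have hexp : ∀ u : ℝ, HasSum (fun n : ℕ => u ^ n / n.factorial) (Real.exp u) := by
    intro u
    rw [Real.exp_eq_exp_ℝ]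
    exact NormedSpace.expSeries_div_hasSum_exp u
  refine hasSum_integral_of_dominated_convergence
    (fun n _ => Real.exp (-t) * (t ^ n / n.factorial)) ?_ ?_ ?_ ?_ ?_
  · exact fun n => (h.integrable_pow_mul n _).aestronglyMeasurable.const_mul _
  · refine fun n => ae_of_all _ fun ω => ?_
    rw [Real.norm_eq_abs, abs_mul, abs_of_nonneg (by positivity)]
    refine mul_le_of_le_one_right (by positivity) ?_
    rw [abs_mul, abs_pow]
    exact mul_le_one₀ (pow_le_one₀ (abs_nonneg _) (h.abs_symbol_le ω)) (abs_nonneg _)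
      (h.abs_le _ ω)
  · exact ae_of_all _ fun ω => ((hexp t).mul_left _).summable
  · exact integrable_const _
  · refine ae_of_all _ fun ω => ?_
    have := ((hexp (t * φ ω)).mul_left (Real.exp (-t))).mul_right (c (y - x) ω)
    rw [← Real.exp_add] at this
    have e : Real.exp (-t * (1 - φ ω)) = Real.exp (-t + t * φ ω) := by ring_nf
    rw [e]
    refine hasSum_of_forall_eq this fun n => ?_
    rw [mul_pow]; ring

theorem poisson_nonneg (h : SpectralFamily S μ φ c) {t : ℝ} (ht : 0 ≤ t) (x y : A) :
    0 ≤ ∫ ω, Real.exp (-t * (1 - φ ω)) * c (y - x) ω ∂μ :=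
  (h.hasSum_poisson ht x y).nonneg fun n =>
    mul_nonneg (by positivity) (walkProb_nonneg _ _ _ _)

/-- This is Γ(n + 1) = n!: the rate-one continuous-time walk spends expected time 1 at each step of
its skeleton, so discrete and continuous Green functions agree. -/
theorem lintegral_poisson_weight (n : ℕ) :
    ∫⁻ t in Set.Ioi (0 : ℝ), ENNReal.ofReal (Real.exp (-t) * (t ^ n / n.factorial)) = 1 := by
  have hG := Real.GammaIntegral_convergent (s := n + 1) (by positivity)
  have hI : ∫ t in Set.Ioi (0 : ℝ), Real.exp (-t) * (t ^ n / n.factorial) = 1 := by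
    have := Real.Gamma_eq_integral (s := n + 1) (by positivity)
    rw [Real.Gamma_nat_eq_factorial] at this
    simp only [add_sub_cancel_right, Real.rpow_natCast] at this
    have h2 : ∀ t : ℝ, Real.exp (-t) * (t ^ n / n.factorial)
        = Real.exp (-t) * t ^ n / n.factorial := fun t => by ring
    simp only [h2]
    rw [integral_div, ← this, div_self (by positivity)]
  rw [← ofReal_integral_eq_lintegral_ofReal, hI, ENNReal.ofReal_one]
  · simp only [add_sub_cancel_right, Real.rpow_natCast] at hG
    refine (hG.div_const (n.factorial : ℝ)).congr (ae_of_all _ fun t => ?_)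
    ring
  · filter_upwards [ae_restrict_mem measurableSet_Ioi] with t ht
    have : (0 : ℝ) < t := ht
    positivity

/-- The Green function is the time integral of the continuous-time transition function. -/
theorem hasSum_walkProb (h : SpectralFamily S μ φ c) (x y : A)
    (hint : IntegrableOn
      (fun t => ∫ ω, Real.exp (-t * (1 - φ ω)) * c (y - x) ω ∂μ) (Set.Ioi (0 : ℝ))) :
    HasSum (fun n => walkProb S n x y)
      (∫ t in Set.Ioi (0 : ℝ), ∫ ω, Real.exp (-t * (1 - φ ω)) * c (y - x) ω ∂μ) := by
  -- Summability over n is not known beforehand. Tonelli in `ENNReal` needs only nonnegativity, and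
  -- finiteness of the right side then yields summability.
  have key : ∑' n, ENNReal.ofReal (walkProb S n x y) = ENNReal.ofReal
      (∫ t in Set.Ioi (0 : ℝ), ∫ ω, Real.exp (-t * (1 - φ ω)) * c (y - x) ω ∂μ) := by
    rw [ofReal_integral_eq_lintegral_ofReal hint
      ((ae_restrict_mem measurableSet_Ioi).mono fun t ht => h.poisson_nonneg (le_of_lt ht) x y)]
    have h1 : ∀ t ∈ Set.Ioi (0 : ℝ), ENNReal.ofReal
        (∫ ω, Real.exp (-t * (1 - φ ω)) * c (y - x) ω ∂μ) = ∑' n : ℕ,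
        ENNReal.ofReal (Real.exp (-t) * (t ^ n / n.factorial)) *
          ENNReal.ofReal (walkProb S n x y) := by
      intro t ht
      have ht' : (0 : ℝ) < t := ht
      rw [← (h.hasSum_poisson ht'.le x y).tsum_eq, ENNReal.ofReal_tsum_of_nonneg
        (fun n => mul_nonneg (by positivity) (walkProb_nonneg _ _ _ _))
        (h.hasSum_poisson ht'.le x y).summable]
      exact tsum_congr fun n => ENNReal.ofReal_mul (by positivity)
    rw [setLIntegral_congr_fun measurableSet_Ioi h1, lintegral_tsum]
    · refine tsum_congr fun n => ?_
      rw [lintegral_mul_const _ (by fun_prop), lintegral_poisson_weight, one_mul]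
    · intro n
      fun_prop
  have hnn : 0 ≤ ∫ t in Set.Ioi (0 : ℝ), ∫ ω, Real.exp (-t * (1 - φ ω)) * c (y - x) ω ∂μ :=
    setIntegral_nonneg measurableSet_Ioi fun t ht => h.poisson_nonneg (le_of_lt ht) x y
  have hs : Summable fun n => walkProb S n x y := by
    have := ENNReal.summable_toReal (key ▸ ENNReal.ofReal_ne_top :
      ∑' n, ENNReal.ofReal (walkProb S n x y) ≠ ⊤)
    simpa only [ENNReal.toReal_ofReal (walkProb_nonneg _ _ _ _)] using this
  rw [← ENNReal.ofReal_tsum_of_nonneg (fun n => walkProb_nonneg _ _ _ _) hs,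
    ENNReal.ofReal_eq_ofReal_iff (tsum_nonneg fun n => walkProb_nonneg _ _ _ _) hnn] at key
  exact key ▸ hs.hasSum

end SpectralFamily

end WalkFourier

section HeatKernel

open MeasureTheory

/-! ### The continuous-time simple random walk on `ℤ` -/

/-- Lebesgue measure on the unit interval, which parametrizes the frequencies. -/
noncomputable abbrev freqMeasure : Measure ℝ := volume.restrict (Set.Ioc (0 : ℝ) 1)

instance isProbabilityMeasure_freqMeasure : IsProbabilityMeasure freqMeasure :=
  ⟨by simp [freqMeasure]⟩

/-- The frequency `x` eigenfunction of the walk, evaluated at `k`. -/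
noncomputable def cosMode (k : ℤ) (x : ℝ) : ℝ := Real.cos (k * (Real.pi * x))

@[fun_prop]
theorem continuous_cosMode (k : ℤ) : Continuous (cosMode k) := by
  unfold cosMode; fun_prop

@[simp]
theorem cosMode_zero (x : ℝ) : cosMode 0 x = 1 := by simp [cosMode]

theorem cosMode_neg (k : ℤ) (x : ℝ) : cosMode (-k) x = cosMode k x := by
  simp [cosMode]

theorem abs_cosMode_le (k : ℤ) (x : ℝ) : |cosMode k x| ≤ 1 := Real.abs_cos_le_one _

theorem cosMode_le (k : ℤ) (x : ℝ) : cosMode k x ≤ 1 := Real.cos_le_one _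

theorem cosMode_sub_add (k : ℤ) (x : ℝ) :
    cosMode (k - 1) x + cosMode (k + 1) x = 2 * (cosMode 1 x * cosMode k x) := by
  simp only [cosMode]
  push_cast
  rw [sub_mul, add_mul, Real.cos_sub, Real.cos_add]
  ring

theorem integral_cosMode (k : ℤ) : ∫ x, cosMode k x ∂freqMeasure = if k = 0 then 1 else 0 := by
  split_ifs with hk
  · simp [hk]
  · have hk' : (k : ℝ) * Real.pi ≠ 0 := mul_ne_zero (by exact_mod_cast hk) Real.pi_ne_zero
    rw [freqMeasure, ← intervalIntegral.integral_of_le zero_le_one]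
    have : ∀ x, cosMode k x = Real.cos (k * Real.pi * x) := fun x => by
      simp [cosMode, mul_assoc]
    simp only [this]
    rw [intervalIntegral.integral_comp_mul_left (fun x => Real.cos x) hk', integral_cos]
    simp [Real.sin_int_mul_pi]

/-- The frequency range (0, 1] covers angles in (0, π], where the cosine has a global quadratic
upper bound. This gives both Gaussian domination and nonvanishing of the denominator 1 - `symbol2`.
-/
theorem two_mul_sq_le_one_sub_cosMode {x : ℝ} (hx : x ∈ Set.Ioc (0 : ℝ) 1) :
    2 * x ^ 2 ≤ 1 - cosMode 1 x := by
  have hpi := Real.pi_pos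
  have h := Real.cos_le_one_sub_mul_cos_sq (x := Real.pi * x) (by
    rw [abs_of_nonneg (mul_nonneg hpi.le hx.1.le)]; nlinarith [hx.2])
  have e : 2 / Real.pi ^ 2 * (Real.pi * x) ^ 2 = 2 * x ^ 2 := by field_simp
  simp only [cosMode, Int.cast_one, one_mul]
  linarith

theorem one_sub_cosMode_le (k : ℤ) {x : ℝ} (hx : x ∈ Set.Ioc (0 : ℝ) 1) :
    1 - cosMode k x ≤ k ^ 2 * Real.pi ^ 2 / 4 * (1 - cosMode 1 x) := by
  have h1 := Real.one_sub_sq_div_two_le_cos (x := k * (Real.pi * x))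
  have h2 := mul_le_mul_of_nonneg_left (two_mul_sq_le_one_sub_cosMode hx)
    (by positivity : 0 ≤ (k : ℝ) ^ 2 * Real.pi ^ 2 / 4)
  have h3 : cosMode k x = Real.cos (k * (Real.pi * x)) := rfl
  rw [h3]
  nlinarith

/-- The steps of the simple random walk on `ℤ`. -/
def steps1 : Finset ℤ := {1, -1}

theorem spectralFamily1 : SpectralFamily steps1 freqMeasure (cosMode 1) cosMode where
  nonempty := ⟨1, by simp [steps1]⟩
  measurable_symbol := (continuous_cosMode 1).measurable
  abs_symbol_le := abs_cosMode_le 1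
  measurable a := (continuous_cosMode a).measurable
  abs_le := abs_cosMode_le
  integral_eq := integral_cosMode
  sum_eq a x := by
    rw [steps1, Finset.sum_pair (by norm_num), sub_neg_eq_add, cosMode_sub_add]
    simp

/-- The transition function at `k` of the simple random walk on `ℤ` with unit jump rate. -/
noncomputable def heatKernel (t : ℝ) (k : ℤ) : ℝ :=
  ∫ x, Real.exp (-t * (1 - cosMode 1 x)) * cosMode k x ∂freqMeasure

theorem hasSum_heatKernel {t : ℝ} (ht : 0 ≤ t) (k : ℤ) :
    HasSum (fun n : ℕ => Real.exp (-t) * (t ^ n / n.factorial) * walkProb steps1 n 0 k)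
      (heatKernel t k) := by
  simpa [heatKernel] using spectralFamily1.hasSum_poisson ht 0 k

theorem heatKernel_nonneg {t : ℝ} (ht : 0 ≤ t) (k : ℤ) : 0 ≤ heatKernel t k := by
  simpa [heatKernel] using spectralFamily1.poisson_nonneg ht 0 k

theorem heatKernel_neg (t : ℝ) (k : ℤ) : heatKernel t (-k) = heatKernel t k := by
  simp only [heatKernel, cosMode_neg]

theorem norm_heatIntegrand_le {t : ℝ} (ht : 0 ≤ t) (k : ℤ) (x : ℝ) :
    ‖Real.exp (-t * (1 - cosMode 1 x)) * cosMode k x‖ ≤ 1 := by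
  rw [Real.norm_eq_abs, abs_mul, Real.abs_exp]
  refine mul_le_one₀ (Real.exp_le_one_iff.mpr ?_) (abs_nonneg _) (abs_cosMode_le k x)
  nlinarith [cosMode_le 1 x]

theorem integrable_heatIntegrand {t : ℝ} (ht : 0 ≤ t) (k : ℤ) :
    Integrable (fun x => Real.exp (-t * (1 - cosMode 1 x)) * cosMode k x) freqMeasure :=
  Integrable.of_bound (by fun_prop) 1 (ae_of_all _ (norm_heatIntegrand_le ht k))

theorem heatKernel_le_zero {t : ℝ} (ht : 0 ≤ t) (k : ℤ) : heatKernel t k ≤ heatKernel t 0 := by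
  refine integral_mono (integrable_heatIntegrand ht k) (integrable_heatIntegrand ht 0) fun x => ?_
  exact mul_le_mul_of_nonneg_left (by simpa using cosMode_le k x) (Real.exp_pos _).le

theorem heatKernel_zero_le_one {t : ℝ} (ht : 0 ≤ t) : heatKernel t 0 ≤ 1 := by
  have := integral_mono (integrable_heatIntegrand ht 0) (integrable_const (1 : ℝ)) fun x =>
    (le_abs_self _).trans (norm_heatIntegrand_le ht 0 x)
  simpa [heatKernel] using this

@[fun_prop]
theorem measurable_heatKernel (k : ℤ) : Measurable fun t => heatKernel t k := by
  have : StronglyMeasurable fun p : ℝ × ℝ =>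
      Real.exp (-p.1 * (1 - cosMode 1 p.2)) * cosMode k p.2 :=
    Continuous.stronglyMeasurable (by fun_prop)
  exact this.integral_prod_right.measurable

/-! ### On-diagonal size of the one-dimensional heat kernel -/

theorem heatKernel_zero_eq (t : ℝ) :
    heatKernel t 0 = ∫ x in Set.Ioc (0 : ℝ) 1, Real.exp (-t * (1 - cosMode 1 x)) := by
  simp [heatKernel, freqMeasure]

/-- The on-diagonal value after rescaling the frequency. -/
theorem sqrt_mul_heatKernel_zero {t : ℝ} (ht : 0 < t) :
    √t * heatKernel t 0 = ∫ u in Set.Ioi (0 : ℝ),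
      (Set.Ioc 0 √t).indicator (fun u => Real.exp (-t * (1 - cosMode 1 (u / √t)))) u := by
  have hs : 0 < √t := Real.sqrt_pos.mpr ht
  rw [heatKernel_zero_eq, ← intervalIntegral.integral_of_le zero_le_one,
    setIntegral_indicator measurableSet_Ioc,
    Set.inter_eq_right.mpr Set.Ioc_subset_Ioi_self, ← intervalIntegral.integral_of_le hs.le,
    intervalIntegral.integral_comp_div (fun x => Real.exp (-t * (1 - cosMode 1 x))) hs.ne']
  simp [hs.ne']

theorem scaledIntegrand_le {t : ℝ} (ht : 0 < t) (u : ℝ) :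
    (Set.Ioc 0 √t).indicator (fun u => Real.exp (-t * (1 - cosMode 1 (u / √t)))) u
      ≤ Real.exp (-2 * u ^ 2) := by
  have hs : 0 < √t := Real.sqrt_pos.mpr ht
  by_cases hu : u ∈ Set.Ioc 0 √t
  · rw [Set.indicator_of_mem hu]
    have h := two_mul_sq_le_one_sub_cosMode (x := u / √t)
      ⟨div_pos hu.1 hs, (div_le_one hs).mpr hu.2⟩
    have := mul_le_mul_of_nonneg_left h ht.le
    rw [div_pow, Real.sq_sqrt ht.le] at this
    have e : t * (2 * (u ^ 2 / t)) = 2 * u ^ 2 := by field_simp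
    exact Real.exp_le_exp.mpr (by linarith)
  · rw [Set.indicator_of_notMem hu]
    positivity

theorem integrable_exp_neg_two_sq : Integrable (fun u : ℝ => Real.exp (-2 * u ^ 2))
    (volume.restrict (Set.Ioi 0)) :=
  (integrable_exp_neg_mul_sq (by norm_num : (0 : ℝ) < 2)).integrableOn

theorem measurable_scaledIntegrand (t : ℝ) : Measurable
    ((Set.Ioc 0 √t).indicator (fun u => Real.exp (-t * (1 - cosMode 1 (u / √t))))) :=
  Measurable.indicator (Continuous.measurable (by fun_prop)) measurableSet_Ioc

theorem scaledIntegrand_nonneg (t u : ℝ) :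
    0 ≤ (Set.Ioc 0 √t).indicator (fun u => Real.exp (-t * (1 - cosMode 1 (u / √t)))) u :=
  Set.indicator_nonneg (fun _ _ => (Real.exp_pos _).le) _

theorem sqrt_mul_heatKernel_zero_le {t : ℝ} (ht : 0 < t) : √t * heatKernel t 0 ≤ 1 := by
  rw [sqrt_mul_heatKernel_zero ht]
  have hle : ∫ u in Set.Ioi (0 : ℝ), (Set.Ioc 0 √t).indicator
      (fun u => Real.exp (-t * (1 - cosMode 1 (u / √t)))) u
      ≤ ∫ u in Set.Ioi (0 : ℝ), Real.exp (-2 * u ^ 2) := by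
    refine integral_mono_of_nonneg (ae_of_all _ (scaledIntegrand_nonneg t))
      integrable_exp_neg_two_sq (ae_of_all _ (scaledIntegrand_le ht))
  refine hle.trans ?_
  rw [integral_gaussian_Ioi]
  have : √(Real.pi / 2) ≤ 2 := Real.sqrt_le_iff.mpr ⟨by norm_num, by linarith [Real.pi_lt_four]⟩
  linarith

theorem heatKernel_zero_sq_le {t : ℝ} (ht : 0 < t) : t * heatKernel t 0 ^ 2 ≤ 1 := by
  have h := pow_le_one₀ (n := 2)
    (mul_nonneg (Real.sqrt_nonneg t) (heatKernel_nonneg ht.le 0)) (sqrt_mul_heatKernel_zero_le ht)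
  rwa [mul_pow, Real.sq_sqrt ht.le] at h

/-- Write 1 - cos 2θ = 2 sin² θ and use continuity of sinc at 0, which avoids a Taylor remainder. -/
theorem tendsto_mul_one_sub_cos_div (u : ℝ) :
    Tendsto (fun t : ℝ => t * (1 - cosMode 1 (u / √t))) atTop (𝓝 (Real.pi ^ 2 / 2 * u ^ 2)) := by
  have hsinc : ∀ t : ℝ, 0 < t → t * (1 - cosMode 1 (u / √t))
      = Real.pi ^ 2 / 2 * u ^ 2 * Real.sinc (Real.pi * (u / √t) / 2) ^ 2 := by
    intro t ht
    have hs : 0 < √t := Real.sqrt_pos.mpr ht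
    rcases eq_or_ne u 0 with rfl | hu
    · simp [cosMode]
    have hne : Real.pi * (u / √t) / 2 ≠ 0 := by
      have := Real.pi_ne_zero
      positivity
    rw [Real.sinc_of_ne_zero hne, cosMode]
    have h2 : ((1 : ℤ) : ℝ) * (Real.pi * (u / √t)) = 2 * (Real.pi * (u / √t) / 2) := by
      push_cast; ring
    rw [h2, Real.cos_two_mul, Real.cos_sq']
    have hst : √t ^ 2 = t := Real.sq_sqrt ht.le
    field_simp
    rw [hst]
    ring
  have hlim : Tendsto (fun t : ℝ => Real.pi * (u / √t) / 2) atTop (𝓝 0) := by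
    have : Tendsto (fun t : ℝ => u / √t) atTop (𝓝 0) :=
      tendsto_const_nhds.div_atTop Real.tendsto_sqrt_atTop
    simpa using (this.const_mul Real.pi).div_const 2
  have h3 : Tendsto (fun t : ℝ => Real.pi ^ 2 / 2 * u ^ 2 *
      Real.sinc (Real.pi * (u / √t) / 2) ^ 2) atTop (𝓝 (Real.pi ^ 2 / 2 * u ^ 2)) := by
    have := ((Real.continuous_sinc.tendsto 0).comp hlim).pow 2
    simpa using this.const_mul (Real.pi ^ 2 / 2 * u ^ 2)
  refine h3.congr' ?_
  filter_upwards [eventually_gt_atTop 0] with t ht using (hsinc t ht).symm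

/-- The local limit theorem at the origin. -/
theorem tendsto_mul_heatKernel_zero_sq :
    Tendsto (fun t => t * heatKernel t 0 ^ 2) atTop (𝓝 (1 / (2 * Real.pi))) := by
  have hpi := Real.pi_pos
  have h1 : Tendsto (fun t => √t * heatKernel t 0) atTop
      (𝓝 (∫ u in Set.Ioi (0 : ℝ), Real.exp (-(Real.pi ^ 2 / 2) * u ^ 2))) := by
    have : Tendsto (fun t => ∫ u in Set.Ioi (0 : ℝ),
        (Set.Ioc 0 √t).indicator (fun u => Real.exp (-t * (1 - cosMode 1 (u / √t)))) u) atTop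
        (𝓝 (∫ u in Set.Ioi (0 : ℝ), Real.exp (-(Real.pi ^ 2 / 2) * u ^ 2))) := by
      -- The Gaussian exp(-2u²) dominates for all t > 0; the cutoff u ≤ √t disappears in the limit.
      refine tendsto_integral_filter_of_dominated_convergence _
        (Eventually.of_forall fun t => (measurable_scaledIntegrand t).aestronglyMeasurable) ?_
        integrable_exp_neg_two_sq ?_
      · filter_upwards [eventually_gt_atTop 0] with t ht
        refine ae_of_all _ fun u => ?_
        rw [Real.norm_eq_abs, abs_of_nonneg (scaledIntegrand_nonneg t u)]
        exact scaledIntegrand_le ht u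
      · filter_upwards [ae_restrict_mem measurableSet_Ioi] with u hu
        have hu' : (0 : ℝ) < u := hu
        have := (Real.continuous_exp.tendsto _).comp (tendsto_mul_one_sub_cos_div u).neg
        rw [← neg_mul] at this
        refine this.congr' ?_
        filter_upwards [Real.tendsto_sqrt_atTop.eventually_ge_atTop u] with t ht
        rw [Set.indicator_of_mem (show u ∈ Set.Ioc 0 √t from ⟨hu', ht⟩)]
        simp
    refine this.congr' ?_
    filter_upwards [eventually_gt_atTop 0] with t ht using (sqrt_mul_heatKernel_zero ht).symm
  rw [integral_gaussian_Ioi] at h1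
  have h2 := h1.pow 2
  have e : (√(Real.pi / (Real.pi ^ 2 / 2)) / 2) ^ 2 = 1 / (2 * Real.pi) := by
    rw [div_pow, Real.sq_sqrt (by positivity)]
    field_simp
  rw [e] at h2
  refine h2.congr' ?_
  filter_upwards [eventually_gt_atTop 0] with t ht
  rw [mul_pow, Real.sq_sqrt ht.le]

/-! ### Mass and variance -/

/-- The three moments go through one induction because the second moment after a step involves the
lower ones. They feed Chebyshev's inequality. -/
theorem hasSum_walkProb_steps1_moments (n : ℕ) :
    HasSum (fun z : ℤ => walkProb steps1 n 0 z) 1 ∧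
    HasSum (fun z : ℤ => (z : ℝ) * walkProb steps1 n 0 z) 0 ∧
    HasSum (fun z : ℤ => (z : ℝ) ^ 2 * walkProb steps1 n 0 z) n := by
  induction n with
  | zero =>
    refine ⟨?_, ?_, ?_⟩
    · simpa [walkProb] using hasSum_ite_eq' (0 : ℤ) (1 : ℝ)
    · convert! (hasSum_zero : HasSum (fun _ : ℤ => (0 : ℝ)) 0) using 2 with z
      by_cases h : z = 0 <;> simp [walkProb, h, eq_comm]
    · convert! (hasSum_zero : HasSum (fun _ : ℤ => (0 : ℝ)) 0) using 2 with z
      · by_cases h : z = 0 <;> simp [walkProb, h, eq_comm]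
      · simp
  | succ n ih =>
    obtain ⟨h0, h1, h2⟩ := ih
    have hstep : ∀ z : ℤ, walkProb steps1 (n + 1) 0 z
        = (walkProb steps1 n 0 (z - 1) + walkProb steps1 n 0 (z + 1)) / 2 := by
      intro z
      simp [walkProb, steps1]
    have hsub : ∀ {f : ℤ → ℝ} {a : ℝ}, HasSum (fun z => f (z + 1)) a → HasSum f a := by
      intro f a h
      exact (Equiv.addRight (1 : ℤ)).hasSum_iff.mp h
    have hadd : ∀ {f : ℤ → ℝ} {a : ℝ}, HasSum (fun z => f (z - 1)) a → HasSum f a := by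
      intro f a h
      exact (Equiv.subRight (1 : ℤ)).hasSum_iff.mp h
    have key : ∀ (q : ℝ → ℝ) (a b : ℝ),
        HasSum (fun z : ℤ => q (z + 1) * walkProb steps1 n 0 z) a →
        HasSum (fun z : ℤ => q (z - 1) * walkProb steps1 n 0 z) b →
        HasSum (fun z : ℤ => q z * walkProb steps1 (n + 1) 0 z) ((a + b) / 2) := by
      intro q a b ha hb
      have ha' : HasSum (fun z : ℤ => q z * walkProb steps1 n 0 (z - 1)) a :=
        hsub (by simpa using ha)
      have hb' : HasSum (fun z : ℤ => q z * walkProb steps1 n 0 (z + 1)) b :=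
        hadd (by simpa using hb)
      refine hasSum_of_forall_eq (((ha'.add hb').div_const 2)) fun z => ?_
      rw [hstep]; ring
    refine ⟨?_, ?_, ?_⟩
    · simpa using key (fun _ => 1) 1 1 (by simpa using h0) (by simpa using h0)
    · have := key (fun z => z) 1 (-1) (by simpa [add_mul] using h1.add h0)
        (by simpa [sub_mul] using h1.sub h0)
      simpa using this
    · have hp : HasSum (fun z : ℤ => ((z : ℝ) + 1) ^ 2 * walkProb steps1 n 0 z) ((n : ℝ) + 1) := by
        have := (h2.add (h1.mul_left 2)).add h0
        simp only [mul_zero, add_zero] at this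
        exact hasSum_of_forall_eq this fun z => by ring
      have hm : HasSum (fun z : ℤ => ((z : ℝ) - 1) ^ 2 * walkProb steps1 n 0 z) ((n : ℝ) + 1) := by
        have := (h2.sub (h1.mul_left 2)).add h0
        simp only [mul_zero, sub_zero] at this
        exact hasSum_of_forall_eq this fun z => by ring
      have := key (fun z => z ^ 2) _ _ hp hm
      push_cast
      convert! this using 1
      ring

theorem sum_walkProb_steps1_le (n : ℕ) (s : Finset ℤ) : ∑ z ∈ s, walkProb steps1 n 0 z ≤ 1 :=
  sum_le_hasSum s (fun _ _ => walkProb_nonneg _ _ _ _) (hasSum_walkProb_steps1_moments n).1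

theorem one_sub_le_sum_walkProb_steps1 (n m : ℕ) (hm : 0 < m) :
    1 - n / (m : ℝ) ^ 2 ≤ ∑ z ∈ Finset.Icc (-m : ℤ) m, walkProb steps1 n 0 z := by
  obtain ⟨h0, -, h2⟩ := hasSum_walkProb_steps1_moments n
  have hm' : (0 : ℝ) < m := by exact_mod_cast hm
  have h := h0.sub (h2.div_const ((m : ℝ) ^ 2))
  refine le_trans ?_ (Finset.sum_le_sum (f := fun z : ℤ => walkProb steps1 n 0 z -
    (z : ℝ) ^ 2 * walkProb steps1 n 0 z / (m : ℝ) ^ 2) fun z _ => ?_)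
  -- Chebyshev: 1 - z²/m² is nonpositive outside the window and at most 1 inside it.
  · rw [← neg_le_neg_iff, ← Finset.sum_neg_distrib]
    refine sum_le_hasSum _ (fun z hz => ?_) h.neg
    rw [Finset.mem_Icc, not_and_or, not_le, not_le] at hz
    have hz2 : (m : ℝ) ^ 2 ≤ (z : ℝ) ^ 2 := by
      have : (m : ℤ) ^ 2 ≤ z ^ 2 := by rcases hz with hz | hz <;> nlinarith
      exact_mod_cast this
    rw [neg_nonneg, sub_nonpos, le_div_iff₀ (by positivity), mul_comm]
    exact mul_le_mul_of_nonneg_right hz2 (walkProb_nonneg _ _ _ _)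
  · have := walkProb_nonneg steps1 n 0 z
    have : 0 ≤ (z : ℝ) ^ 2 * walkProb steps1 n 0 z / (m : ℝ) ^ 2 := by positivity
    linarith

theorem hasSum_poisson_weight (t : ℝ) :
    HasSum (fun n : ℕ => Real.exp (-t) * (t ^ n / n.factorial)) 1 := by
  have h : HasSum (fun n : ℕ => t ^ n / n.factorial) (Real.exp t) := by
    rw [Real.exp_eq_exp_ℝ]
    exact NormedSpace.expSeries_div_hasSum_exp t
  have := h.mul_left (Real.exp (-t))
  rwa [← Real.exp_add, neg_add_cancel, Real.exp_zero] at this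

theorem hasSum_poisson_weight_mul (t : ℝ) :
    HasSum (fun n : ℕ => Real.exp (-t) * (t ^ n / n.factorial) * n) t := by
  rw [← hasSum_nat_add_iff' 1]
  have := (hasSum_poisson_weight t).mul_left t
  simp only [Finset.range_one, Finset.sum_singleton, Nat.cast_zero, mul_zero, sub_zero]
  rw [mul_one] at this
  refine hasSum_of_forall_eq (this) fun n => ?_
  rw [Nat.factorial_succ]
  push_cast
  field_simp
  ring

theorem hasSum_sum_heatKernel {t : ℝ} (ht : 0 ≤ t) (s : Finset ℤ) :
    HasSum (fun n : ℕ => Real.exp (-t) * (t ^ n / n.factorial) *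
      ∑ z ∈ s, walkProb steps1 n 0 z) (∑ z ∈ s, heatKernel t z) := by
  have := hasSum_sum (s := s) fun z _ => hasSum_heatKernel ht z
  simpa only [Finset.mul_sum] using this

theorem sum_heatKernel_le {t : ℝ} (ht : 0 ≤ t) (s : Finset ℤ) : ∑ z ∈ s, heatKernel t z ≤ 1 :=
  hasSum_le (fun n => mul_le_of_le_one_right (by positivity) (sum_walkProb_steps1_le n s))
    (hasSum_sum_heatKernel ht s) (hasSum_poisson_weight t)

theorem one_sub_le_sum_heatKernel {t : ℝ} (ht : 0 ≤ t) {m : ℕ} (hm : 0 < m) :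
    1 - t / (m : ℝ) ^ 2 ≤ ∑ z ∈ Finset.Icc (-m : ℤ) m, heatKernel t z := by
  refine hasSum_le (fun n => ?_)
    ((hasSum_poisson_weight t).sub ((hasSum_poisson_weight_mul t).div_const ((m : ℝ) ^ 2)))
    (hasSum_sum_heatKernel ht _)
  rw [mul_div_assoc, ← mul_one_sub]
  exact mul_le_mul_of_nonneg_left (one_sub_le_sum_walkProb_steps1 n m hm) (by positivity)

/-- Conservation of mass, obtained by letting the window in the Chebyshev bound grow. -/
theorem hasSum_heatKernel_one {t : ℝ} (ht : 0 ≤ t) : HasSum (fun z : ℤ => heatKernel t z) 1 := by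
  have hs : Summable fun z : ℤ => heatKernel t z :=
    summable_of_sum_le (heatKernel_nonneg ht) (sum_heatKernel_le ht)
  have h1 : ∑' z : ℤ, heatKernel t z ≤ 1 := hs.tsum_le_of_sum_le (sum_heatKernel_le ht)
  have h2 : 1 ≤ ∑' z : ℤ, heatKernel t z := by
    have hlim : Tendsto (fun m : ℕ => 1 - t / (m : ℝ) ^ 2) atTop (𝓝 1) := by
      have : Tendsto (fun m : ℕ => t / (m : ℝ) ^ 2) atTop (𝓝 0) :=
        tendsto_const_nhds.div_atTop
          ((tendsto_pow_atTop two_ne_zero).comp tendsto_natCast_atTop_atTop)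
      simpa using this.const_sub 1
    refine le_of_tendsto hlim ?_
    filter_upwards [eventually_gt_atTop 0] with m hm
    exact (one_sub_le_sum_heatKernel ht hm).trans
      (hs.sum_le_tsum _ fun z _ => heatKernel_nonneg ht z)
  exact (le_antisymm h1 h2) ▸ hs.hasSum

end HeatKernel

section PlaneAndSpace

open MeasureTheory

/-! ### The simple random walks on `ℤ²` and `ℤ³` -/

noncomputable abbrev freqMeasure2 : Measure (ℝ × ℝ) := freqMeasure.prod freqMeasure

noncomputable abbrev freqMeasure3 : Measure ((ℝ × ℝ) × ℝ) := freqMeasure2.prod freqMeasure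

noncomputable def cosMode2 (u : ℤ × ℤ) (ω : ℝ × ℝ) : ℝ := cosMode u.1 ω.1 * cosMode u.2 ω.2

noncomputable def cosMode3 (u : (ℤ × ℤ) × ℤ) (ω : (ℝ × ℝ) × ℝ) : ℝ :=
  cosMode2 u.1 ω.1 * cosMode u.2 ω.2

noncomputable def symbol2 (ω : ℝ × ℝ) : ℝ := (cosMode 1 ω.1 + cosMode 1 ω.2) / 2

noncomputable def symbol3 (ω : (ℝ × ℝ) × ℝ) : ℝ :=
  (cosMode 1 ω.1.1 + cosMode 1 ω.1.2 + cosMode 1 ω.2) / 3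

@[fun_prop]
theorem continuous_cosMode2 (u : ℤ × ℤ) : Continuous (cosMode2 u) := by
  unfold cosMode2; fun_prop

@[fun_prop]
theorem continuous_symbol2 : Continuous symbol2 := by
  unfold symbol2; fun_prop

theorem abs_cosMode2_le (u : ℤ × ℤ) (ω : ℝ × ℝ) : |cosMode2 u ω| ≤ 1 := by
  rw [cosMode2, abs_mul]
  exact mul_le_one₀ (abs_cosMode_le _ _) (abs_nonneg _) (abs_cosMode_le _ _)

theorem spectralFamily2 : SpectralFamily steps2 freqMeasure2 symbol2 cosMode2 where
  nonempty := ⟨(1, 0), by simp [steps2]⟩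
  measurable_symbol := continuous_symbol2.measurable
  abs_symbol_le ω := by
    have h1 := abs_le.mp (abs_cosMode_le 1 ω.1)
    have h2 := abs_le.mp (abs_cosMode_le 1 ω.2)
    rw [symbol2, abs_le]
    constructor <;> linarith
  measurable u := (continuous_cosMode2 u).measurable
  abs_le := abs_cosMode2_le
  integral_eq u := by
    simp only [cosMode2]
    rw [integral_prod_mul (cosMode u.1) (cosMode u.2), integral_cosMode, integral_cosMode]
    by_cases h1 : u.1 = 0 <;> by_cases h2 : u.2 = 0 <;> simp [h1, h2, Prod.ext_iff]
  sum_eq u ω := by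
    have h1 := cosMode_sub_add u.1 ω.1
    have h2 := cosMode_sub_add u.2 ω.2
    have hc : steps2.card = 4 := by decide
    rw [hc]
    simp only [steps2, cosMode2, symbol2]
    rw [Finset.sum_insert (by decide), Finset.sum_insert (by decide),
      Finset.sum_insert (by decide), Finset.sum_singleton]
    simp only [Prod.fst_sub, Prod.snd_sub, sub_zero, sub_neg_eq_add]
    push_cast
    linear_combination cosMode u.2 ω.2 * h1 + cosMode u.1 ω.1 * h2

theorem spectralFamily3 : SpectralFamily steps3 freqMeasure3 symbol3 cosMode3 where
  nonempty := ⟨((1, 0), 0), by simp [steps3]⟩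
  measurable_symbol := by unfold symbol3; fun_prop
  abs_symbol_le ω := by
    have h1 := abs_le.mp (abs_cosMode_le 1 ω.1.1)
    have h2 := abs_le.mp (abs_cosMode_le 1 ω.1.2)
    have h3 := abs_le.mp (abs_cosMode_le 1 ω.2)
    rw [symbol3, abs_le]
    constructor <;> linarith
  measurable u := by unfold cosMode3; fun_prop
  abs_le u ω := by
    rw [cosMode3, abs_mul]
    exact mul_le_one₀ (abs_cosMode2_le _ _) (abs_nonneg _) (abs_cosMode_le _ _)
  integral_eq u := by
    simp only [cosMode3]
    rw [integral_prod_mul (cosMode2 u.1) (cosMode u.2), integral_cosMode,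
      spectralFamily2.integral_eq]
    by_cases h1 : u.1 = 0 <;> by_cases h2 : u.2 = 0 <;> simp [h1, h2, Prod.ext_iff]
  sum_eq u ω := by
    have h1 := cosMode_sub_add u.1.1 ω.1.1
    have h2 := cosMode_sub_add u.1.2 ω.1.2
    have h3 := cosMode_sub_add u.2 ω.2
    have hc : steps3.card = 6 := by decide
    rw [hc]
    simp only [steps3, cosMode3, cosMode2, symbol3]
    rw [Finset.sum_insert (by decide), Finset.sum_insert (by decide),
      Finset.sum_insert (by decide), Finset.sum_insert (by decide),
      Finset.sum_insert (by decide), Finset.sum_singleton]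
    simp only [Prod.fst_sub, Prod.snd_sub, sub_zero, sub_neg_eq_add]
    push_cast
    linear_combination cosMode u.1.2 ω.1.2 * cosMode u.2 ω.2 * h1 +
      cosMode u.1.1 ω.1.1 * cosMode u.2 ω.2 * h2 + cosMode u.1.1 ω.1.1 * cosMode u.1.2 ω.1.2 * h3

/-- At time 2t the planar walk has independent coordinates, each a rate-one walk at time t, because
the exponential of the symbol factorizes. The same holds on ℤ³ at time 3t. -/
theorem integral_poisson2 (t : ℝ) (u : ℤ × ℤ) :
    ∫ ω, Real.exp (-(2 * t) * (1 - symbol2 ω)) * cosMode2 u ω ∂freqMeasure2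
      = heatKernel t u.1 * heatKernel t u.2 := by
  rw [heatKernel, heatKernel, ← integral_prod_mul]
  refine integral_congr_ae (ae_of_all _ fun ω => ?_)
  simp only [symbol2, cosMode2]
  rw [mul_mul_mul_comm, ← Real.exp_add]
  ring_nf

theorem integral_poisson3 (t : ℝ) (u : (ℤ × ℤ) × ℤ) :
    ∫ ω, Real.exp (-(3 * t) * (1 - symbol3 ω)) * cosMode3 u ω ∂freqMeasure3
      = heatKernel t u.1.1 * heatKernel t u.1.2 * heatKernel t u.2 := by
  rw [← integral_poisson2 t u.1, heatKernel, ← integral_prod_mul]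
  refine integral_congr_ae (ae_of_all _ fun ω => ?_)
  simp only [symbol3, symbol2, cosMode3]
  rw [mul_mul_mul_comm, ← Real.exp_add]
  ring_nf

/-! ### The Green function as a time integral -/

/-- Transience in dimension three: the integrand is at most 1 near zero and at most t^(-3/2) at
infinity. -/
theorem integrableOn_heatKernel_zero_cube :
    IntegrableOn (fun t => heatKernel t 0 ^ 3) (Set.Ioi (0 : ℝ)) := by
  have hm : Measurable fun t => heatKernel t 0 ^ 3 := by fun_prop
  rw [← Set.Ioc_union_Ioi_eq_Ioi (zero_le_one' ℝ)]
  refine IntegrableOn.union ?_ ?_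
  · refine Measure.integrableOn_of_bounded (M := 1) (by simp) hm.aestronglyMeasurable ?_
    filter_upwards [ae_restrict_mem measurableSet_Ioc] with t ht
    rw [Real.norm_eq_abs, abs_of_nonneg (pow_nonneg (heatKernel_nonneg ht.1.le 0) 3)]
    exact pow_le_one₀ (heatKernel_nonneg ht.1.le 0) (heatKernel_zero_le_one ht.1.le)
  · have hI := integrableOn_Ioi_rpow_of_lt (a := -(3 / 2)) (c := 1) (by norm_num) one_pos
    refine Integrable.mono' hI hm.aestronglyMeasurable ?_
    filter_upwards [ae_restrict_mem measurableSet_Ioi] with t ht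
    have ht0 : 0 < t := lt_trans one_pos ht
    rw [Real.norm_eq_abs, abs_of_nonneg (pow_nonneg (heatKernel_nonneg ht0.le 0) 3)]
    have hle : heatKernel t 0 ≤ t ^ (-(1 / 2) : ℝ) := by
      rw [Real.rpow_neg ht0.le, ← Real.sqrt_eq_rpow, ← one_div,
        le_div_iff₀ (Real.sqrt_pos.mpr ht0), mul_comm]
      exact sqrt_mul_heatKernel_zero_le ht0
    calc heatKernel t 0 ^ 3 ≤ (t ^ (-(1 / 2) : ℝ)) ^ 3 :=
          pow_le_pow_left₀ (heatKernel_nonneg ht0.le 0) hle 3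
      _ = t ^ (-(3 / 2) : ℝ) := by
          rw [← Real.rpow_natCast, ← Real.rpow_mul ht0.le]; norm_num

theorem integrableOn_heatKernel_mul (k l z : ℤ) :
    IntegrableOn (fun t => heatKernel t k * heatKernel t l * heatKernel t z)
      (Set.Ioi (0 : ℝ)) := by
  refine Integrable.mono' integrableOn_heatKernel_zero_cube
    (Measurable.aestronglyMeasurable (by fun_prop)) ?_
  filter_upwards [ae_restrict_mem measurableSet_Ioi] with t ht
  have ht0 : 0 ≤ t := le_of_lt ht
  have h0 := heatKernel_nonneg ht0
  rw [Real.norm_eq_abs, abs_of_nonneg (mul_nonneg (mul_nonneg (h0 k) (h0 l)) (h0 z)), pow_three']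
  exact mul_le_mul (mul_le_mul (heatKernel_le_zero ht0 k) (heatKernel_le_zero ht0 l) (h0 l) (h0 0))
    (heatKernel_le_zero ht0 z) (h0 z) (mul_nonneg (h0 0) (h0 0))

theorem integrableOn_heatKernel_zero_sq_mul (z : ℤ) :
    IntegrableOn (fun t => heatKernel t 0 ^ 2 * heatKernel t z) (Set.Ioi (0 : ℝ)) := by
  simpa only [sq] using integrableOn_heatKernel_mul 0 0 z

theorem hasSum_walkProb_steps3 (x x' : (ℤ × ℤ) × ℤ) :
    HasSum (fun n => walkProb steps3 n x x') (3 * ∫ t in Set.Ioi (0 : ℝ),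
      heatKernel t (x' - x).1.1 * heatKernel t (x' - x).1.2 * heatKernel t (x' - x).2) := by
  set H : ℝ → ℝ := fun t => ∫ ω, Real.exp (-t * (1 - symbol3 ω)) * cosMode3 (x' - x) ω ∂freqMeasure3
    with hH
  have h3 : ∀ t, H (3 * t) =
      heatKernel t (x' - x).1.1 * heatKernel t (x' - x).1.2 * heatKernel t (x' - x).2 :=
    fun t => integral_poisson3 t (x' - x)
  have hint : IntegrableOn H (Set.Ioi 0) := by
    have := integrableOn_Ioi_comp_mul_left_iff H 0 (a := 3) (by norm_num)
    rw [mul_zero] at this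
    refine this.mp ?_
    simp only [h3]
    exact integrableOn_heatKernel_mul _ _ _
  have hval : ∫ t in Set.Ioi (0 : ℝ), H t = 3 * ∫ t in Set.Ioi (0 : ℝ),
      heatKernel t (x' - x).1.1 * heatKernel t (x' - x).1.2 * heatKernel t (x' - x).2 := by
    -- The prefactor 3 of the Green function is the Jacobian of the time change t ↦ 3t.
    have := integral_comp_mul_left_Ioi H 0 (b := 3) (by norm_num)
    simp only [h3, mul_zero, smul_eq_mul] at this
    rw [this]; ring
  rw [← hval]
  exact spectralFamily3.hasSum_walkProb x x' hint

/-- The defect of the planar transition function at `u` with respect to its value at `0`. -/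
noncomputable def heatDefect (u : ℤ × ℤ) (t : ℝ) : ℝ :=
  heatKernel t 0 ^ 2 - heatKernel t u.1 * heatKernel t u.2

theorem heatDefect_nonneg (u : ℤ × ℤ) {t : ℝ} (ht : 0 ≤ t) : 0 ≤ heatDefect u t := by
  rw [heatDefect, sub_nonneg, sq]
  exact mul_le_mul (heatKernel_le_zero ht _) (heatKernel_le_zero ht _) (heatKernel_nonneg ht _)
    (heatKernel_nonneg ht _)

@[fun_prop]
theorem measurable_heatDefect (u : ℤ × ℤ) : Measurable (heatDefect u) := by
  unfold heatDefect; fun_prop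

/-- The Green function on the vertical axis. -/
noncomputable def axisGreen (z : ℤ) : ℝ :=
  3 * ∫ t in Set.Ioi (0 : ℝ), heatKernel t 0 ^ 2 * heatKernel t z

/-- The difference of the Green function between the axis and the column above `u`. -/
noncomputable def greenDefect (u : ℤ × ℤ) (z : ℤ) : ℝ :=
  3 * ∫ t in Set.Ioi (0 : ℝ), heatDefect u t * heatKernel t z

theorem integrableOn_heatDefect_mul (u : ℤ × ℤ) (z : ℤ) :
    IntegrableOn (fun t => heatDefect u t * heatKernel t z) (Set.Ioi (0 : ℝ)) := by
  have := (integrableOn_heatKernel_mul 0 0 z).sub (integrableOn_heatKernel_mul u.1 u.2 z)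
  refine this.congr (ae_of_all _ fun t => ?_)
  simp only [heatDefect, Pi.sub_apply]
  ring

theorem green_eq (x x' : (ℤ × ℤ) × ℤ) :
    green x x' = axisGreen (x'.2 - x.2) - greenDefect (x'.1 - x.1) (x'.2 - x.2) := by
  rw [green, (hasSum_walkProb_steps3 x x').tsum_eq, axisGreen, greenDefect, ← mul_sub,
    ← integral_sub _ (integrableOn_heatDefect_mul _ _)]
  · congr 1
    refine integral_congr_ae (ae_of_all _ fun t => ?_)
    simp only [heatDefect, Prod.fst_sub, Prod.snd_sub]
    ring
  · exact integrableOn_heatKernel_zero_sq_mul _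

theorem axisGreen_nonneg (z : ℤ) : 0 ≤ axisGreen z :=
  mul_nonneg (by norm_num) (setIntegral_nonneg measurableSet_Ioi fun _ ht =>
    mul_nonneg (sq_nonneg _) (heatKernel_nonneg (le_of_lt ht) z))

theorem greenDefect_nonneg (u : ℤ × ℤ) (z : ℤ) : 0 ≤ greenDefect u z :=
  mul_nonneg (by norm_num) (setIntegral_nonneg measurableSet_Ioi fun _ ht =>
    mul_nonneg (heatDefect_nonneg u (le_of_lt ht)) (heatKernel_nonneg (le_of_lt ht) z))

theorem axisGreen_neg (z : ℤ) : axisGreen (-z) = axisGreen z := by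
  simp only [axisGreen, heatKernel_neg]

theorem greenDefect_neg (u : ℤ × ℤ) (z : ℤ) : greenDefect u (-z) = greenDefect u z := by
  simp only [greenDefect, heatKernel_neg]

/-! ### The potential kernel -/

theorem ae_freqMeasure2 : ∀ᵐ ω ∂freqMeasure2, ω.1 ∈ Set.Ioo (0 : ℝ) 1 ∧ ω.2 ∈ Set.Ioo (0 : ℝ) 1 := by
  have h : freqMeasure = volume.restrict (Set.Ioo (0 : ℝ) 1) :=
    (Measure.restrict_congr_set Ioo_ae_eq_Ioc).symm
  rw [freqMeasure2, h, Measure.prod_restrict]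
  exact ae_restrict_mem (measurableSet_Ioo.prod measurableSet_Ioo)

theorem symbol2_lt_one {ω : ℝ × ℝ} (h : ω.1 ∈ Set.Ioo (0 : ℝ) 1 ∧ ω.2 ∈ Set.Ioo (0 : ℝ) 1) :
    symbol2 ω < 1 := by
  have h1 := two_mul_sq_le_one_sub_cosMode ⟨h.1.1, h.1.2.le⟩
  have h2 := cosMode_le 1 ω.2
  have h3 := sq_pos_of_pos h.1.1
  rw [symbol2]
  linarith

/-- The walk has period 2, so the symbol equals -1 at the corner (1, 1). Away from the boundary of
the square the geometric series in the symbol converges. -/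
theorem abs_symbol2_lt_one {ω : ℝ × ℝ} (h : ω.1 ∈ Set.Ioo (0 : ℝ) 1 ∧ ω.2 ∈ Set.Ioo (0 : ℝ) 1) :
    |symbol2 ω| < 1 := by
  refine abs_lt.mpr ⟨?_, symbol2_lt_one h⟩
  have h1 : -1 < cosMode 1 ω.1 := by
    have hpi := Real.pi_pos
    rw [cosMode, Int.cast_one, one_mul, ← Real.cos_pi]
    exact Real.cos_lt_cos_of_nonneg_of_le_pi (mul_nonneg hpi.le h.1.1.le) le_rfl
      (by nlinarith [h.1.2])
  have h2 := (abs_le.mp (abs_cosMode_le 1 ω.2)).1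
  rw [symbol2]
  linarith

theorem one_sub_cosMode2_nonneg (u : ℤ × ℤ) (ω : ℝ × ℝ) : 0 ≤ 1 - cosMode2 u ω :=
  sub_nonneg.mpr ((le_abs_self _).trans (abs_cosMode2_le u ω))

/-- The numerator vanishes at the origin at least to the same order as the denominator, which makes
`potentialDensity` bounded although 1/(1 - `symbol2`) is not integrable. -/
theorem one_sub_cosMode2_le (u : ℤ × ℤ) {ω : ℝ × ℝ}
    (h : ω.1 ∈ Set.Ioo (0 : ℝ) 1 ∧ ω.2 ∈ Set.Ioo (0 : ℝ) 1) :
    1 - cosMode2 u ω ≤ ((u.1 : ℝ) ^ 2 + u.2 ^ 2) * Real.pi ^ 2 / 2 * (1 - symbol2 ω) := by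
  have h1 := one_sub_cosMode_le u.1 ⟨h.1.1, h.1.2.le⟩
  have h2 := one_sub_cosMode_le u.2 ⟨h.2.1, h.2.2.le⟩
  have h3 : 1 - cosMode2 u ω ≤ (1 - cosMode u.1 ω.1) + (1 - cosMode u.2 ω.2) := by
    rw [cosMode2]
    nlinarith [cosMode_le u.1 ω.1, cosMode_le u.2 ω.2]
  have h4 : 0 ≤ (u.1 : ℝ) ^ 2 * Real.pi ^ 2 / 4 * (1 - cosMode 1 ω.2) :=
    mul_nonneg (by positivity) (by linarith [cosMode_le 1 ω.2])
  have h5 : 0 ≤ (u.2 : ℝ) ^ 2 * Real.pi ^ 2 / 4 * (1 - cosMode 1 ω.1) :=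
    mul_nonneg (by positivity) (by linarith [cosMode_le 1 ω.1])
  rw [symbol2]
  linarith

/-- The spectral density of the potential kernel. -/
noncomputable def potentialDensity (u : ℤ × ℤ) (ω : ℝ × ℝ) : ℝ :=
  (1 - cosMode2 u ω) / (1 - symbol2 ω)

theorem measurable_potentialDensity (u : ℤ × ℤ) : Measurable (potentialDensity u) := by
  unfold potentialDensity
  exact Measurable.div (Continuous.measurable (by fun_prop)) (Continuous.measurable (by fun_prop))

theorem ae_potentialDensity_mem (u : ℤ × ℤ) : ∀ᵐ ω ∂freqMeasure2,
    0 ≤ potentialDensity u ω ∧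
      potentialDensity u ω ≤ ((u.1 : ℝ) ^ 2 + u.2 ^ 2) * Real.pi ^ 2 / 2 := by
  filter_upwards [ae_freqMeasure2] with ω hω
  have h1 : 0 < 1 - symbol2 ω := sub_pos.mpr (symbol2_lt_one hω)
  exact ⟨div_nonneg (one_sub_cosMode2_nonneg u ω) h1.le,
    (div_le_iff₀ h1).mpr (one_sub_cosMode2_le u hω)⟩

theorem integrable_potentialDensity (u : ℤ × ℤ) : Integrable (potentialDensity u) freqMeasure2 := by
  refine Integrable.of_bound (measurable_potentialDensity u).aestronglyMeasurable
    (((u.1 : ℝ) ^ 2 + u.2 ^ 2) * Real.pi ^ 2 / 2) ?_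
  filter_upwards [ae_potentialDensity_mem u] with ω hω
  rw [Real.norm_eq_abs, abs_of_nonneg hω.1]
  exact hω.2

theorem potentialSum_eq (u : ℤ × ℤ) (n : ℕ) : potentialSum u n =
    ∫ ω, (1 - cosMode2 u ω) * ∑ j ∈ Finset.range (n + 1), symbol2 ω ^ j ∂freqMeasure2 := by
  have h : ∀ j : ℕ, walkProb steps2 j 0 0 - walkProb steps2 j 0 u
      = ∫ ω, (1 - cosMode2 u ω) * symbol2 ω ^ j ∂freqMeasure2 := by
    intro j
    rw [spectralFamily2.walkProb_eq, spectralFamily2.walkProb_eq,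
      ← integral_sub (spectralFamily2.integrable_pow_mul _ _)
        (spectralFamily2.integrable_pow_mul _ _)]
    refine integral_congr_ae (ae_of_all _ fun ω => ?_)
    simp [cosMode2]
    ring
  simp only [potentialSum, h, Finset.mul_sum]
  rw [integral_finsetSum]
  intro j _
  refine ((spectralFamily2.integrable_pow_mul j 0).sub
    (spectralFamily2.integrable_pow_mul j u)).congr (ae_of_all _ fun ω => ?_)
  simp [cosMode2]
  ring

/-- The partial sums have density (1 - φ^(n+1)) times `potentialDensity`, with φ = `symbol2`. Since
|φ| ≤ 1, twice the density dominates. -/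
theorem tendsto_potentialSum_integral (u : ℤ × ℤ) :
    Tendsto (potentialSum u) atTop (𝓝 (∫ ω, potentialDensity u ω ∂freqMeasure2)) := by
  simp only [funext (potentialSum_eq u)]
  refine tendsto_integral_filter_of_dominated_convergence (fun ω => 2 * potentialDensity u ω)
    (Eventually.of_forall fun n => Continuous.aestronglyMeasurable (by fun_prop)) ?_
    ((integrable_potentialDensity u).const_mul 2) ?_
  · refine Eventually.of_forall fun n => ?_
    filter_upwards [ae_freqMeasure2] with ω hω
    have h1 : 0 < 1 - symbol2 ω := sub_pos.mpr (symbol2_lt_one hω)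
    have hg : ∑ j ∈ Finset.range (n + 1), symbol2 ω ^ j
        = (1 - symbol2 ω ^ (n + 1)) / (1 - symbol2 ω) := by
      rw [eq_div_iff h1.ne', geom_sum_mul_neg]
    have hp : |symbol2 ω ^ (n + 1)| ≤ 1 := by
      rw [abs_pow]
      exact pow_le_one₀ (abs_nonneg _) (abs_symbol2_lt_one hω).le
    have hp2 : |1 - symbol2 ω ^ (n + 1)| ≤ 2 := by
      rw [abs_le] at hp ⊢
      constructor <;> linarith
    rw [hg, Real.norm_eq_abs, mul_div_assoc', abs_div, abs_mul, abs_of_pos h1,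
      abs_of_nonneg (one_sub_cosMode2_nonneg u ω), potentialDensity, mul_div_assoc', mul_comm]
    gcongr
    exact one_sub_cosMode2_nonneg u ω
  · filter_upwards [ae_freqMeasure2] with ω hω
    have := (hasSum_geometric_of_abs_lt_one (abs_symbol2_lt_one hω)).tendsto_sum_nat
    exact ((tendsto_add_atTop_iff_nat 1).mpr this).const_mul _

/-- Integrating exp(-2t(1 - φ)) over t, with φ = `symbol2`, gives 1/(2(1 - φ)); the half reflects
that the planar walk jumps at rate 2 here. -/
theorem lintegral_heatDefect (u : ℤ × ℤ) :
    ∫⁻ t in Set.Ioi (0 : ℝ), ENNReal.ofReal (heatDefect u t)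
      = ENNReal.ofReal ((∫ ω, potentialDensity u ω ∂freqMeasure2) / 2) := by
  have hD : ∀ t ∈ Set.Ioi (0 : ℝ), ENNReal.ofReal (heatDefect u t) =
      ∫⁻ ω, ENNReal.ofReal (Real.exp (-(2 * t) * (1 - symbol2 ω)) * (1 - cosMode2 u ω))
        ∂freqMeasure2 := by
    intro t ht
    have ht0 : (0 : ℝ) < t := ht
    have hint : ∀ v, Integrable
        (fun ω => Real.exp (-(2 * t) * (1 - symbol2 ω)) * cosMode2 v ω) freqMeasure2 := by
      intro v
      refine Integrable.of_bound (Continuous.aestronglyMeasurable (by fun_prop)) 1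
        (ae_of_all _ fun ω => ?_)
      rw [Real.norm_eq_abs, abs_mul, Real.abs_exp]
      refine mul_le_one₀ (Real.exp_le_one_iff.mpr ?_) (abs_nonneg _) (abs_cosMode2_le v ω)
      nlinarith [(abs_le.mp (spectralFamily2.abs_symbol_le ω)).2]
    have e : ∀ ω, Real.exp (-(2 * t) * (1 - symbol2 ω)) * (1 - cosMode2 u ω) =
        Real.exp (-(2 * t) * (1 - symbol2 ω)) * cosMode2 0 ω -
          Real.exp (-(2 * t) * (1 - symbol2 ω)) * cosMode2 u ω := by
      intro ω
      simp [cosMode2]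
      ring
    rw [← ofReal_integral_eq_lintegral_ofReal]
    · simp only [e]
      rw [integral_sub (hint 0) (hint u), integral_poisson2, integral_poisson2, heatDefect, sq]
      rfl
    · simp only [e]
      exact (hint 0).sub (hint u)
    · exact ae_of_all _ fun ω => mul_nonneg (Real.exp_pos _).le (one_sub_cosMode2_nonneg u ω)
  rw [setLIntegral_congr_fun measurableSet_Ioi hD, lintegral_lintegral_swap, ← integral_div,
    ofReal_integral_eq_lintegral_ofReal ((integrable_potentialDensity u).div_const 2)
      ((ae_potentialDensity_mem u).mono fun ω h => div_nonneg h.1 zero_le_two)]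
  · refine lintegral_congr_ae ?_
    filter_upwards [ae_freqMeasure2] with ω hω
    have h1 : 0 < 1 - symbol2 ω := sub_pos.mpr (symbol2_lt_one hω)
    have h2 : -(2 * (1 - symbol2 ω)) < 0 := by linarith
    have hI := integrableOn_exp_mul_Ioi h2 0
    have e : ∀ t, Real.exp (-(2 * t) * (1 - symbol2 ω)) * (1 - cosMode2 u ω)
        = Real.exp (-(2 * (1 - symbol2 ω)) * t) * (1 - cosMode2 u ω) := by
      intro t; ring_nf
    simp only [e]
    rw [← ofReal_integral_eq_lintegral_ofReal (hI.mul_const _)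
      (ae_of_all _ fun t => mul_nonneg (Real.exp_pos _).le (one_sub_cosMode2_nonneg u ω)),
      integral_mul_const, integral_exp_mul_Ioi h2, potentialDensity]
    congr 1
    rw [mul_zero, Real.exp_zero]
    field_simp
  · exact Measurable.aemeasurable (Continuous.measurable (by fun_prop)).ennreal_ofReal

theorem potentialKernel_eq_integral (u : ℤ × ℤ) :
    potentialKernel u = ∫ ω, potentialDensity u ω ∂freqMeasure2 :=
  (tendsto_potentialSum_integral u).limUnder_eq

theorem tendsto_potentialSum (u : ℤ × ℤ) :
    Tendsto (potentialSum u) atTop (𝓝 (potentialKernel u)) :=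
  potentialKernel_eq_integral u ▸ tendsto_potentialSum_integral u

/-- Projecting the spatial walk onto the plane turns the Green function into the potential
kernel. -/
theorem hasSum_greenDefect (u : ℤ × ℤ) :
    HasSum (fun z => greenDefect u z) (3 / 2 * potentialKernel u) := by
  have hpos : 0 ≤ 3 / 2 * potentialKernel u := by
    rw [potentialKernel_eq_integral]
    exact mul_nonneg (by norm_num)
      (integral_nonneg_of_ae ((ae_potentialDensity_mem u).mono fun ω h => h.1))
  have key : ∑' z, ENNReal.ofReal (greenDefect u z)
      = ENNReal.ofReal (3 / 2 * potentialKernel u) := by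
    have h1 : ∀ z, ENNReal.ofReal (greenDefect u z) = ENNReal.ofReal 3 *
        ∫⁻ t in Set.Ioi (0 : ℝ), ENNReal.ofReal (heatDefect u t) *
          ENNReal.ofReal (heatKernel t z) := by
      intro z
      rw [greenDefect, ENNReal.ofReal_mul (by norm_num),
        ofReal_integral_eq_lintegral_ofReal (integrableOn_heatDefect_mul u z)]
      · congr 1
        refine setLIntegral_congr_fun measurableSet_Ioi fun t ht => ?_
        exact ENNReal.ofReal_mul (heatDefect_nonneg u (le_of_lt ht))
      · filter_upwards [ae_restrict_mem measurableSet_Ioi] with t ht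
        exact mul_nonneg (heatDefect_nonneg u (le_of_lt ht)) (heatKernel_nonneg (le_of_lt ht) z)
    simp only [h1]
    rw [ENNReal.tsum_mul_left, ← lintegral_tsum fun z => by fun_prop]
    -- The vertical walk has total mass 1 at every time, so the sum over z removes it.
    have h2 : ∀ t ∈ Set.Ioi (0 : ℝ), ∑' z, ENNReal.ofReal (heatDefect u t) *
        ENNReal.ofReal (heatKernel t z) = ENNReal.ofReal (heatDefect u t) := by
      intro t ht
      have ht0 : (0 : ℝ) < t := ht
      have hs := hasSum_heatKernel_one ht0.le
      rw [ENNReal.tsum_mul_left, ← ENNReal.ofReal_tsum_of_nonneg (heatKernel_nonneg ht0.le)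
        hs.summable, hs.tsum_eq, ENNReal.ofReal_one, mul_one]
    rw [setLIntegral_congr_fun measurableSet_Ioi h2, lintegral_heatDefect,
      ← ENNReal.ofReal_mul (by norm_num), potentialKernel_eq_integral]
    congr 1
    ring
  have hs : Summable fun z => greenDefect u z := by
    have := ENNReal.summable_toReal (key ▸ ENNReal.ofReal_ne_top :
      ∑' z, ENNReal.ofReal (greenDefect u z) ≠ ⊤)
    simpa only [ENNReal.toReal_ofReal (greenDefect_nonneg u _)] using this
  rw [← ENNReal.ofReal_tsum_of_nonneg (greenDefect_nonneg u) hs,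
    ENNReal.ofReal_eq_ofReal_iff (tsum_nonneg (greenDefect_nonneg u)) hpos] at key
  exact key ▸ hs.hasSum

end PlaneAndSpace

section AxisAsymptotics

open MeasureTheory

/-! ### Logarithmic growth of the Green function summed along the axis -/

/-- The sum of `f` over the symmetric window `[-m, m]`. -/
noncomputable def windowSum (f : ℤ → ℝ) (m : ℕ) : ℝ := ∑ z ∈ Finset.Icc (-m : ℤ) m, f z

theorem windowSum_axisGreen (m : ℕ) : windowSum axisGreen m =
    3 * ∫ t in Set.Ioi (0 : ℝ), heatKernel t 0 ^ 2 * windowSum (heatKernel t) m := by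
  simp only [windowSum, axisGreen, Finset.mul_sum]
  rw [integral_finsetSum _ fun z _ => integrableOn_heatKernel_zero_sq_mul z, Finset.mul_sum]

theorem windowSum_heatKernel_nonneg {t : ℝ} (ht : 0 ≤ t) (m : ℕ) :
    0 ≤ windowSum (heatKernel t) m :=
  Finset.sum_nonneg fun z _ => heatKernel_nonneg ht z

theorem windowSum_heatKernel_le {t : ℝ} (ht : 0 ≤ t) (m : ℕ) :
    windowSum (heatKernel t) m ≤ (2 * m + 1) * heatKernel t 0 := by
  have := Finset.sum_le_card_nsmul (Finset.Icc (-m : ℤ) m) (heatKernel t) _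
    fun z _ => heatKernel_le_zero ht z
  rw [Int.card_Icc, nsmul_eq_mul] at this
  have e : ((m + 1 - -(m : ℤ)).toNat : ℝ) = 2 * m + 1 := by
    have : (m + 1 - -(m : ℤ)).toNat = 2 * m + 1 := by omega
    rw [this]; push_cast; ring
  rwa [e] at this

/-- Substitution t = exp(c v). With c = 2 log m, the times between 1 and m² become v in [0, 1], and
dt/t becomes 2 log m dv. -/
theorem integral_Ioi_eq_integral_exp {c : ℝ} (hc : 0 < c) (f : ℝ → ℝ) :
    ∫ t in Set.Ioi (0 : ℝ), f t = c * ∫ v, Real.exp (c * v) * f (Real.exp (c * v)) := by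
  have himg : (fun v => Real.exp (c * v)) '' Set.univ = Set.Ioi 0 := by
    ext y
    simp only [Set.image_univ, Set.mem_range, Set.mem_Ioi]
    constructor
    · rintro ⟨v, rfl⟩; exact Real.exp_pos _
    · intro hy
      exact ⟨Real.log y / c, by rw [mul_div_cancel₀ _ hc.ne', Real.exp_log hy]⟩
  have hinj : Set.InjOn (fun v => Real.exp (c * v)) Set.univ := fun a _ b _ h =>
    mul_left_cancel₀ hc.ne' (Real.exp_injective h)
  have hder : ∀ v ∈ (Set.univ : Set ℝ), HasDerivWithinAt (fun v => Real.exp (c * v))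
      (Real.exp (c * v) * c) Set.univ v := by
    intro v _
    have := ((hasDerivAt_id v).const_mul c).exp
    simpa using this.hasDerivWithinAt (s := Set.univ)
  rw [← himg, integral_image_eq_integral_abs_deriv_smul MeasurableSet.univ hder hinj,
    setIntegral_univ, ← integral_const_mul]
  refine integral_congr_ae (ae_of_all _ fun v => ?_)
  simp only [smul_eq_mul, abs_of_pos (mul_pos (Real.exp_pos (c * v)) hc)]
  ring

/-- The integrand of the window sum of the Green function in logarithmic time `t = m ^ (2 v)`. -/
noncomputable def logTimeIntegrand (m : ℕ) (v : ℝ) : ℝ :=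
  Real.exp (2 * Real.log m * v) * (heatKernel (Real.exp (2 * Real.log m * v)) 0 ^ 2 *
    windowSum (heatKernel (Real.exp (2 * Real.log m * v))) m)

theorem windowSum_axisGreen_div_log {m : ℕ} (hm : 1 < m) :
    windowSum axisGreen m / Real.log m = 6 * ∫ v, logTimeIntegrand m v := by
  have hlog : 0 < Real.log m := Real.log_pos (by exact_mod_cast hm)
  rw [windowSum_axisGreen, integral_Ioi_eq_integral_exp (mul_pos two_pos hlog)]
  simp only [logTimeIntegrand]
  field_simp
  ring

theorem logTimeIntegrand_nonneg (m : ℕ) (v : ℝ) : 0 ≤ logTimeIntegrand m v :=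
  mul_nonneg (Real.exp_pos _).le
    (mul_nonneg (sq_nonneg _) (windowSum_heatKernel_nonneg (Real.exp_pos _).le m))

theorem measurable_logTimeIntegrand (m : ℕ) : Measurable (logTimeIntegrand m) := by
  unfold logTimeIntegrand windowSum
  have h : ∀ k, Measurable fun v : ℝ => heatKernel (Real.exp (2 * Real.log m * v)) k := fun k =>
    (measurable_heatKernel k).comp (by fun_prop)
  have h2 : Measurable fun v : ℝ => ∑ z ∈ Finset.Icc (-m : ℤ) m,
      heatKernel (Real.exp (2 * Real.log m * v)) z := Finset.measurable_fun_sum _ fun z _ => h z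
  exact Measurable.mul (by fun_prop) (((h 0).pow_const 2).mul h2)

/-- This bound serves v < 0 (times below 1); the next two serve 0 ≤ v ≤ 1 and v > 1 (times beyond
m²). -/
theorem logTimeIntegrand_le_exp (m : ℕ) (v : ℝ) :
    logTimeIntegrand m v ≤ Real.exp (2 * Real.log m * v) := by
  have ht := (Real.exp_pos (2 * Real.log m * v)).le
  refine mul_le_of_le_one_right ht (mul_le_one₀ ?_ (windowSum_heatKernel_nonneg ht m)
    (sum_heatKernel_le ht _))
  exact pow_le_one₀ (heatKernel_nonneg ht 0) (heatKernel_zero_le_one ht)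

theorem logTimeIntegrand_le_one (m : ℕ) (v : ℝ) : logTimeIntegrand m v ≤ 1 := by
  have ht := Real.exp_pos (2 * Real.log m * v)
  rw [logTimeIntegrand, ← mul_assoc]
  exact mul_le_one₀ (heatKernel_zero_sq_le ht) (windowSum_heatKernel_nonneg ht.le m)
    (sum_heatKernel_le ht.le _)

theorem logTimeIntegrand_le_exp_neg {m : ℕ} (hm : 1 ≤ m) (v : ℝ) :
    logTimeIntegrand m v ≤ 3 * Real.exp (Real.log m * (1 - v)) := by
  have ht := Real.exp_pos (2 * Real.log m * v)
  have hm' : (1 : ℝ) ≤ m := by exact_mod_cast hm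
  set t := Real.exp (2 * Real.log m * v) with htdef
  have hsq : √t = Real.exp (Real.log m * v) := by
    rw [htdef, Real.sqrt_eq_rpow, ← Real.exp_mul]; ring_nf
  have hle : heatKernel t 0 ≤ Real.exp (-(Real.log m * v)) := by
    rw [Real.exp_neg, ← hsq, ← one_div, le_div_iff₀ (Real.sqrt_pos.mpr ht), mul_comm]
    exact sqrt_mul_heatKernel_zero_le ht
  calc logTimeIntegrand m v = t * heatKernel t 0 ^ 2 * windowSum (heatKernel t) m := by
        rw [logTimeIntegrand, ← htdef, mul_assoc]
    -- Beyond time m² the window holds only a small part of the mass: at most its cardinality times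
    -- t^(-1/2).
    _ ≤ 1 * ((2 * m + 1) * heatKernel t 0) :=
        mul_le_mul (heatKernel_zero_sq_le ht) (windowSum_heatKernel_le ht.le m)
          (windowSum_heatKernel_nonneg ht.le m) zero_le_one
    _ ≤ 3 * m * Real.exp (-(Real.log m * v)) := by
        rw [one_mul]
        exact mul_le_mul (by linarith) hle (heatKernel_nonneg ht.le 0) (by positivity)
    _ = 3 * Real.exp (Real.log m * (1 - v)) := by
        rw [mul_one_sub, sub_eq_add_neg, Real.exp_add, Real.exp_log (by linarith)]; ring

theorem logTimeIntegrand_le_dominator {m : ℕ} (hm : 1 ≤ Real.log m) (v : ℝ) :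
    logTimeIntegrand m v ≤ 3 * Real.exp 1 * Real.exp (-|v|) := by
  have hm1 : 1 ≤ m := by
    by_contra h
    have : m = 0 := by omega
    norm_num [this] at hm
  have h3 : 1 ≤ 3 * Real.exp 1 := by linarith [Real.one_le_exp zero_le_one]
  rcases le_total v 0 with hv | hv
  · refine (logTimeIntegrand_le_exp m v).trans ?_
    rw [abs_of_nonpos hv, neg_neg]
    refine le_trans (Real.exp_le_exp.mpr ?_) (le_mul_of_one_le_left (Real.exp_pos _).le h3)
    nlinarith
  · rw [abs_of_nonneg hv, mul_assoc, ← Real.exp_add]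
    rcases le_total v 1 with hv1 | hv1
    · refine (logTimeIntegrand_le_one m v).trans ?_
      linarith [Real.one_le_exp (by linarith : 0 ≤ 1 + -v)]
    · refine (logTimeIntegrand_le_exp_neg hm1 v).trans ?_
      gcongr
      nlinarith

theorem integrable_exp_neg_abs : Integrable fun v : ℝ => Real.exp (-|v|) := by
  rw [← integrableOn_univ, ← Set.Iic_union_Ioi (a := (0 : ℝ))]
  refine IntegrableOn.union ?_ ?_
  · refine (integrableOn_exp_mul_Iic one_pos 0).congr_fun (fun v hv => ?_) measurableSet_Iic
    simp [abs_of_nonpos (Set.mem_Iic.mp hv)]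
  · refine (integrableOn_exp_neg_Ioi 0).congr_fun (fun v hv => ?_) measurableSet_Ioi
    simp [abs_of_pos (Set.mem_Ioi.mp hv)]

theorem tendsto_log_natCast : Tendsto (fun m : ℕ => Real.log m) atTop atTop :=
  Real.tendsto_log_atTop.comp tendsto_natCast_atTop_atTop

/-- For 0 < v < 1 the time m^(2v) is large, so the local limit theorem gives 1/(2π), yet far below
m², so the window holds asymptotically all the mass. The two excluded values of v form a null set.
-/
theorem tendsto_logTimeIntegrand {v : ℝ} (h0 : v ≠ 0) (h1 : v ≠ 1) :
    Tendsto (fun m : ℕ => logTimeIntegrand m v) atTop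
      (𝓝 ((Set.Ioc (0 : ℝ) 1).indicator (fun _ => 1 / (2 * Real.pi)) v)) := by
  rcases lt_or_gt_of_ne h0 with hv | hv
  · rw [Set.indicator_of_notMem fun h => absurd h.1 hv.not_gt]
    refine squeeze_zero (fun m => logTimeIntegrand_nonneg m v)
      (fun m => logTimeIntegrand_le_exp m v) (Real.tendsto_exp_atBot.comp ?_)
    exact (tendsto_log_natCast.const_mul_atTop two_pos).atTop_mul_const_of_neg hv
  rcases lt_or_gt_of_ne h1 with hv1 | hv1
  · rw [Set.indicator_of_mem (show v ∈ Set.Ioc 0 1 from ⟨hv, hv1.le⟩)]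
    have htop : Tendsto (fun m : ℕ => Real.exp (2 * Real.log m * v)) atTop atTop :=
      Real.tendsto_exp_atTop.comp
        ((tendsto_log_natCast.const_mul_atTop two_pos).atTop_mul_const hv)
    have hA := tendsto_mul_heatKernel_zero_sq.comp htop
    have hB : Tendsto (fun m : ℕ => windowSum (heatKernel (Real.exp (2 * Real.log m * v))) m)
        atTop (𝓝 1) := by
      have hlow : Tendsto (fun m : ℕ => 1 - Real.exp (2 * Real.log m * (v - 1))) atTop (𝓝 1) := by
        have := Real.tendsto_exp_atBot.comp ((tendsto_log_natCast.const_mul_atTop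
          two_pos).atTop_mul_const_of_neg (sub_neg.mpr hv1))
        simpa using this.const_sub 1
      refine tendsto_of_tendsto_of_tendsto_of_le_of_le' hlow tendsto_const_nhds ?_
        (Eventually.of_forall fun m => sum_heatKernel_le (Real.exp_pos _).le _)
      filter_upwards [eventually_gt_atTop 0] with m hm
      have hm' : (0 : ℝ) < m := by exact_mod_cast hm
      refine le_trans (le_of_eq ?_) (one_sub_le_sum_heatKernel (Real.exp_pos _).le hm)
      rw [mul_sub, mul_one, Real.exp_sub]
      congr 2
      rw [two_mul, Real.exp_add, Real.exp_log hm', sq]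
    have := hA.mul hB
    rw [mul_one] at this
    refine this.congr fun m => ?_
    rw [logTimeIntegrand, ← mul_assoc]
    rfl
  · rw [Set.indicator_of_notMem fun h => absurd h.2 hv1.not_ge]
    have hlim : Tendsto (fun m : ℕ => 3 * Real.exp (Real.log m * (1 - v))) atTop (𝓝 0) := by
      have := Real.tendsto_exp_atBot.comp
        (tendsto_log_natCast.atTop_mul_const_of_neg (sub_neg.mpr hv1))
      simpa using this.const_mul 3
    refine tendsto_of_tendsto_of_tendsto_of_le_of_le' tendsto_const_nhds hlim
      (Eventually.of_forall fun m => logTimeIntegrand_nonneg m v) ?_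
    filter_upwards [eventually_ge_atTop 1] with m hm using logTimeIntegrand_le_exp_neg hm v

theorem tendsto_windowSum_axisGreen_div_log :
    Tendsto (fun m : ℕ => windowSum axisGreen m / Real.log m) atTop (𝓝 (3 / Real.pi)) := by
  have hlim : Tendsto (fun m : ℕ => ∫ v, logTimeIntegrand m v) atTop
      (𝓝 (∫ v, (Set.Ioc (0 : ℝ) 1).indicator (fun _ => 1 / (2 * Real.pi)) v)) := by
    refine tendsto_integral_filter_of_dominated_convergence
      (fun v => 3 * Real.exp 1 * Real.exp (-|v|))
      (Eventually.of_forall fun m => (measurable_logTimeIntegrand m).aestronglyMeasurable) ?_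
      (integrable_exp_neg_abs.const_mul _) ?_
    · filter_upwards [tendsto_log_natCast.eventually_ge_atTop 1] with m hm
      refine ae_of_all _ fun v => ?_
      rw [Real.norm_eq_abs, abs_of_nonneg (logTimeIntegrand_nonneg m v)]
      exact logTimeIntegrand_le_dominator hm v
    · filter_upwards [Measure.ae_ne volume (0 : ℝ), Measure.ae_ne volume (1 : ℝ)] with v h0 h1
      exact tendsto_logTimeIntegrand h0 h1
  rw [integral_indicator measurableSet_Ioc] at hlim
  have := hlim.const_mul 6
  -- The 6 is the Green function prefactor 3 times the 2 from t = m^(2v).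
  have e : 6 * ∫ _ in Set.Ioc (0 : ℝ) 1, 1 / (2 * Real.pi) = 3 / Real.pi := by
    simp
    field_simp
    norm_num
  rw [e] at this
  refine this.congr' ?_
  filter_upwards [eventually_gt_atTop 1] with m hm using (windowSum_axisGreen_div_log hm).symm

end AxisAsymptotics

section RodAverages

/-! ### Averages over the rod `[1, N]` -/

theorem Icc_neg_succ_eq_insert (a b : ℕ) :
    Finset.Icc (-((a + 1 : ℕ) : ℤ)) b = insert (-((a + 1 : ℕ) : ℤ)) (Finset.Icc (-a : ℤ) b) := by
  ext z
  simp only [Finset.mem_insert, Finset.mem_Icc]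
  omega

theorem sum_Icc_neg_eq (f : ℤ → ℝ) (a b : ℕ) : ∑ z ∈ Finset.Icc (-a : ℤ) b, f z =
    f 0 + ∑ i ∈ Finset.range a, f (-(i + 1)) + ∑ i ∈ Finset.range b, f (i + 1) := by
  induction a with
  | zero =>
    induction b with
    | zero => simp
    | succ b ih =>
      have : Finset.Icc (-(0 : ℕ) : ℤ) (b + 1 : ℕ)
          = insert ((b + 1 : ℕ) : ℤ) (Finset.Icc (-(0 : ℕ) : ℤ) b) := by
        ext z
        simp only [Finset.mem_insert, Finset.mem_Icc]
        omega
      rw [this, Finset.sum_insert (by simp), ih, Finset.sum_range_succ]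
      push_cast
      ring
  | succ a ih =>
    rw [Icc_neg_succ_eq_insert, Finset.sum_insert (by simp), ih, Finset.sum_range_succ]
    push_cast
    ring

theorem sum_Icc_neg_eq_windowSum {f : ℤ → ℝ} (hf : ∀ z, f (-z) = f z) (a b : ℕ) :
    ∑ z ∈ Finset.Icc (-a : ℤ) b, f z = (windowSum f a + windowSum f b) / 2 := by
  simp only [windowSum, sum_Icc_neg_eq, hf]
  ring

theorem windowSum_mono {f : ℤ → ℝ} (h0 : ∀ z, 0 ≤ f z) : Monotone (windowSum f) := fun a b hab =>
  Finset.sum_le_sum_of_subset_of_nonneg (Finset.Icc_subset_Icc (by omega) (by omega))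
    fun z _ _ => h0 z

/-- The convolution of `h`, restricted to the rod `[1, N]`, with the kernel `f`. -/
noncomputable def rodConv (f : ℤ → ℝ) (N : ℕ) (h : ℤ → ℝ) (z : ℤ) : ℝ :=
  ∑ z' ∈ Finset.Icc (1 : ℤ) N, f (z' - z) * h z'

/-- Seen from z, the rod is the interval [-(z - 1), N - z]; evenness turns it into the average of
two symmetric windows. -/
theorem sum_rod_kernel_eq {f : ℤ → ℝ} (hf : ∀ z, f (-z) = f z) {N : ℕ} {z : ℤ}
    (hz : z ∈ Finset.Icc (1 : ℤ) N) : ∑ z' ∈ Finset.Icc (1 : ℤ) N, f (z' - z) =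
      (windowSum f (z - 1).toNat + windowSum f (N - z).toNat) / 2 := by
  rw [Finset.mem_Icc] at hz
  rw [← sum_Icc_neg_eq_windowSum hf]
  refine Finset.sum_nbij' (fun z' => z' - z) (fun w => w + z) ?_ ?_ ?_ ?_ ?_
  · intro w hw
    rw [Finset.mem_Icc] at hw ⊢
    omega
  · intro w hw
    rw [Finset.mem_Icc] at hw ⊢
    omega
  · intro w _; ring
  · intro w _; ring
  · intro w _; rfl

theorem sum_rod_kernel_le {f : ℤ → ℝ} (h0 : ∀ z, 0 ≤ f z) (hf : ∀ z, f (-z) = f z) {N : ℕ} {z : ℤ}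
    (hz : z ∈ Finset.Icc (1 : ℤ) N) :
    ∑ z' ∈ Finset.Icc (1 : ℤ) N, f (z' - z) ≤ windowSum f N := by
  rw [sum_rod_kernel_eq hf hz]
  rw [Finset.mem_Icc] at hz
  have h1 := windowSum_mono h0 (show (z - 1).toNat ≤ N by omega)
  have h2 := windowSum_mono h0 (show (N - z).toNat ≤ N by omega)
  linarith

theorem sum_rod_eq_sum_range (X : ℕ → ℝ) (N : ℕ) :
    ∑ z ∈ Finset.Icc (1 : ℤ) N, X (z - 1).toNat = ∑ m ∈ Finset.range N, X m := by
  refine Finset.sum_nbij' (fun z => (z - 1).toNat) (fun m => (m : ℤ) + 1) ?_ ?_ ?_ ?_ ?_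
  · intro w hw
    rw [Finset.mem_Icc] at hw
    rw [Finset.mem_range]
    omega
  · intro w hw
    rw [Finset.mem_range] at hw
    rw [Finset.mem_Icc]
    omega
  · intro w hw
    rw [Finset.mem_Icc] at hw
    omega
  · intro w _
    simp
  · intro w _; rfl

theorem sum_rod_rev_eq_sum_range (X : ℕ → ℝ) (N : ℕ) :
    ∑ z ∈ Finset.Icc (1 : ℤ) N, X (N - z).toNat = ∑ m ∈ Finset.range N, X m := by
  refine Finset.sum_nbij' (fun z => (N - z).toNat) (fun m => (N : ℤ) - m) ?_ ?_ ?_ ?_ ?_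
  · intro w hw
    rw [Finset.mem_Icc] at hw
    rw [Finset.mem_range]
    omega
  · intro w hw
    rw [Finset.mem_range] at hw
    rw [Finset.mem_Icc]
    omega
  · intro w hw
    rw [Finset.mem_Icc] at hw
    omega
  · intro w hw
    simp
  · intro w _; rfl

/-- As z runs over the rod, z - 1 and N - z each run once over 0, ..., N - 1. -/
theorem sum_abs_rod_kernel_sub_le {f : ℤ → ℝ} (hf : ∀ z, f (-z) = f z) (N : ℕ) (l κ : ℝ) :
    ∑ z ∈ Finset.Icc (1 : ℤ) N, |(∑ z' ∈ Finset.Icc (1 : ℤ) N, f (z' - z)) / l - κ| ≤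
      ∑ m ∈ Finset.range N, |windowSum f m / l - κ| := by
  have h1 := sum_rod_eq_sum_range (fun m => |windowSum f m / l - κ|) N
  have h2 := sum_rod_rev_eq_sum_range (fun m => |windowSum f m / l - κ|) N
  have h3 : ∑ z ∈ Finset.Icc (1 : ℤ) N, |(∑ z' ∈ Finset.Icc (1 : ℤ) N, f (z' - z)) / l - κ| ≤
      ∑ z ∈ Finset.Icc (1 : ℤ) N, (|windowSum f (z - 1).toNat / l - κ| / 2 +
        |windowSum f (N - z).toNat / l - κ| / 2) := by
    refine Finset.sum_le_sum fun z hz => ?_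
    rw [sum_rod_kernel_eq hf hz]
    have e : (windowSum f (z - 1).toNat + windowSum f (N - z).toNat) / 2 / l - κ =
        (windowSum f (z - 1).toNat / l - κ) / 2 + (windowSum f (N - z).toNat / l - κ) / 2 := by
      ring
    rw [e]
    refine (abs_add_le _ _).trans (le_of_eq ?_)
    rw [abs_div, abs_div, abs_two]
  rw [Finset.sum_add_distrib, ← Finset.sum_div, ← Finset.sum_div, h1, h2, add_halves] at h3
  exact h3

/-! ### Convergence in mean over the rods -/

/-- The functions `h N` converge to the constant `η` in mean over the rods `[1, N]`. -/
def MeanTendsto (h : ℕ → ℤ → ℝ) (η : ℝ) : Prop :=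
  Tendsto (fun N : ℕ => (∑ z ∈ Finset.Icc (1 : ℤ) N, |h N z - η|) / N) atTop (𝓝 0)

namespace MeanTendsto

theorem of_le {h : ℕ → ℤ → ℝ} {η : ℝ} {e : ℕ → ℝ} (he : Tendsto e atTop (𝓝 0))
    (hle : ∀ᶠ N : ℕ in atTop, (∑ z ∈ Finset.Icc (1 : ℤ) N, |h N z - η|) / N ≤ e N) :
    MeanTendsto h η :=
  tendsto_of_tendsto_of_tendsto_of_le_of_le' tendsto_const_nhds he
    (Eventually.of_forall fun N => div_nonneg (Finset.sum_nonneg fun _ _ => abs_nonneg _)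
      N.cast_nonneg) hle

theorem of_pointwise {h : ℕ → ℤ → ℝ} {η : ℝ} {e : ℕ → ℝ} (he : Tendsto e atTop (𝓝 0))
    (hle : ∀ᶠ N : ℕ in atTop, ∀ z ∈ Finset.Icc (1 : ℤ) N, |h N z - η| ≤ e N) :
    MeanTendsto h η := by
  refine of_le he ?_
  filter_upwards [hle, eventually_gt_atTop 0] with N hN hpos
  have := Finset.sum_le_card_nsmul _ _ _ hN
  rw [Int.card_Icc, nsmul_eq_mul] at this
  rw [div_le_iff₀ (by exact_mod_cast hpos)]
  refine this.trans (le_of_eq ?_)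
  rw [show (N + 1 - 1 : ℤ).toNat = N by omega, mul_comm]

theorem const (η : ℝ) : MeanTendsto (fun _ _ => η) η := by
  simp [MeanTendsto]

theorem congr {h h' : ℕ → ℤ → ℝ} {η : ℝ} (H : MeanTendsto h η)
    (e : ∀ᶠ N : ℕ in atTop, ∀ z ∈ Finset.Icc (1 : ℤ) N, h N z = h' N z) : MeanTendsto h' η := by
  refine Tendsto.congr' ?_ H
  filter_upwards [e] with N hN
  rw [Finset.sum_congr rfl fun z hz => by rw [hN z hz]]

theorem add {h h' : ℕ → ℤ → ℝ} {η η' : ℝ} (H : MeanTendsto h η) (H' : MeanTendsto h' η') :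
    MeanTendsto (fun N z => h N z + h' N z) (η + η') := by
  have := Tendsto.add H H'
  rw [add_zero] at this
  refine of_le this (Eventually.of_forall fun N => ?_)
  rw [← add_div, ← Finset.sum_add_distrib]
  gcongr with z _
  rw [add_sub_add_comm]
  exact abs_add_le _ _

theorem const_mul {h : ℕ → ℤ → ℝ} {η : ℝ} (H : MeanTendsto h η) (c : ℝ) :
    MeanTendsto (fun N z => c * h N z) (c * η) := by
  have := Tendsto.const_mul |c| H
  rw [mul_zero] at this
  refine of_le this (Eventually.of_forall fun N => ?_)
  rw [← mul_div_assoc, Finset.mul_sum]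
  simp only [← mul_sub, abs_mul, le_refl]

theorem sum {ι : Type} (s : Finset ι) {h : ι → ℕ → ℤ → ℝ} {η : ι → ℝ}
    (H : ∀ i ∈ s, MeanTendsto (h i) (η i)) :
    MeanTendsto (fun N z => ∑ i ∈ s, h i N z) (∑ i ∈ s, η i) := by
  classical
  induction s using Finset.induction_on with
  | empty => simpa using const 0
  | insert i s hi ih =>
    simp only [Finset.sum_insert hi]
    exact (H i (Finset.mem_insert_self i s)).add
      (ih fun j hj => H j (Finset.mem_insert_of_mem hj))

theorem tendsto_mean {h : ℕ → ℤ → ℝ} {η : ℝ} (H : MeanTendsto h η) :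
    Tendsto (fun N : ℕ => (∑ z ∈ Finset.Icc (1 : ℤ) N, h N z) / N) atTop (𝓝 η) := by
  rw [← tendsto_sub_nhds_zero_iff]
  refine squeeze_zero_norm' ?_ H
  filter_upwards [eventually_gt_atTop 0] with N hN
  have hN' : (0 : ℝ) < N := by exact_mod_cast hN
  have : (∑ z ∈ Finset.Icc (1 : ℤ) N, h N z) / N - η
      = (∑ z ∈ Finset.Icc (1 : ℤ) N, (h N z - η)) / N := by
    rw [Finset.sum_sub_distrib, Finset.sum_const, Int.card_Icc, nsmul_eq_mul,
      show (N + 1 - 1 : ℤ).toNat = N by omega]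
    field_simp
  rw [this, Real.norm_eq_abs, abs_div, abs_of_pos hN']
  gcongr
  exact Finset.abs_sum_le_sum_abs _ _

/-- Convolution with an even nonnegative kernel whose mass `κ l N` over the rod is asymptotically
independent of the base point preserves convergence in mean. -/
theorem rodConv {f : ℤ → ℝ} (h0 : ∀ z, 0 ≤ f z) (hf : ∀ z, f (-z) = f z) {l : ℕ → ℝ} {C κ : ℝ}
    (hl : ∀ᶠ N in atTop, 0 < l N) (hC : ∀ᶠ N in atTop, windowSum f N ≤ C * l N)
    (hκ : Tendsto (fun N : ℕ => (∑ m ∈ Finset.range N, |windowSum f m / l N - κ|) / N)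
      atTop (𝓝 0))
    {h : ℕ → ℤ → ℝ} {η : ℝ} (H : MeanTendsto h η) :
    MeanTendsto (fun N z => _root_.rodConv f N (h N) z / l N) (κ * η) := by
  have hlim := (Tendsto.const_mul C H).add (Tendsto.const_mul |η| hκ)
  simp only [mul_zero, add_zero] at hlim
  refine of_le hlim ?_
  filter_upwards [hl, hC] with N hlN hCN
  rw [← mul_div_assoc, ← mul_div_assoc, ← add_div]
  refine div_le_div_of_nonneg_right ?_ N.cast_nonneg
  set R := Finset.Icc (1 : ℤ) N
  have hpt : ∀ z ∈ R, |_root_.rodConv f N (h N) z / l N - κ * η| ≤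
      (∑ z' ∈ R, f (z' - z) * |h N z' - η|) / l N
        + |η| * |(∑ z' ∈ R, f (z' - z)) / l N - κ| := by
    intro z _
    -- The error splits into the convolution of h - η and η times the fluctuation of the kernel's
    -- mass.
    have e : _root_.rodConv f N (h N) z / l N - κ * η =
        (∑ z' ∈ R, f (z' - z) * (h N z' - η)) / l N +
          η * ((∑ z' ∈ R, f (z' - z)) / l N - κ) := by
      simp only [_root_.rodConv, mul_sub, Finset.sum_sub_distrib, ← Finset.sum_mul, R]
      ring
    rw [e]
    refine (abs_add_le _ _).trans (add_le_add ?_ (abs_mul _ _).le)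
    rw [abs_div, abs_of_pos hlN]
    gcongr
    refine (Finset.abs_sum_le_sum_abs _ _).trans (Finset.sum_le_sum fun z' _ => ?_)
    rw [abs_mul, abs_of_nonneg (h0 _)]
  refine (Finset.sum_le_sum hpt).trans ?_
  rw [Finset.sum_add_distrib, ← Finset.sum_div, ← Finset.mul_sum]
  refine add_le_add ?_
    (mul_le_mul_of_nonneg_left (sum_abs_rod_kernel_sub_le hf N _ _) (abs_nonneg _))
  -- Schur's test: after exchanging sums, the evenness of f bounds the column sums by the window
  -- sum.
  rw [Finset.sum_comm, div_le_iff₀ hlN]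
  calc ∑ z' ∈ R, ∑ z ∈ R, f (z' - z) * |h N z' - η|
      = ∑ z' ∈ R, (∑ z ∈ R, f (z - z')) * |h N z' - η| := by
        refine Finset.sum_congr rfl fun z' _ => ?_
        rw [Finset.sum_mul]
        refine Finset.sum_congr rfl fun z _ => ?_
        rw [← hf, neg_sub]
    _ ≤ ∑ z' ∈ R, C * l N * |h N z' - η| := Finset.sum_le_sum fun z' hz' =>
        mul_le_mul_of_nonneg_right ((sum_rod_kernel_le h0 hf hz').trans hCN) (abs_nonneg _)
    _ = C * ∑ z' ∈ R, |h N z' - η| * l N := by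
        rw [Finset.mul_sum]
        exact Finset.sum_congr rfl fun z' _ => by ring
    _ = C * (∑ z' ∈ R, |h N z' - η|) * l N := by rw [← Finset.sum_mul, mul_assoc]

end MeanTendsto

/-! ### The two kernels -/

theorem sum_range_log_natCast (N : ℕ) :
    ∑ m ∈ Finset.range (N + 1), Real.log m = Real.log (N.factorial) := by
  induction N with
  | zero => simp
  | succ N ih =>
    rw [Finset.sum_range_succ, ih, Nat.factorial_succ, Nat.cast_mul,
      Real.log_mul (by positivity) (by positivity), add_comm]

/-- This is N^N / N! ≤ e^N in logarithmic form. The extra log N is the term m = 0, where `Real.log 0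
= 0`. Hence log m is close to log N for most m < N. -/
theorem sum_range_log_sub_le {N : ℕ} (hN : 0 < N) :
    ∑ m ∈ Finset.range N, (Real.log N - Real.log m) ≤ N + Real.log N := by
  have hN' : (0 : ℝ) < N := by exact_mod_cast hN
  have h1 := sum_range_log_natCast N
  rw [Finset.sum_range_succ] at h1
  have h2 := Real.log_le_log (by positivity) (Real.pow_div_factorial_le_exp (N : ℝ) N.cast_nonneg N)
  rw [Real.log_exp, Real.log_div (by positivity) (by positivity), Real.log_pow] at h2
  rw [Finset.sum_sub_distrib, Finset.sum_const, Finset.card_range, nsmul_eq_mul]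
  linarith

theorem tendsto_mean_of_tendsto_div_log {u : ℕ → ℝ} {κ : ℝ}
    (h : Tendsto (fun m : ℕ => u m / Real.log m) atTop (𝓝 κ)) :
    Tendsto (fun N : ℕ => (∑ m ∈ Finset.range N, |u m / Real.log N - κ|) / N) atTop (𝓝 0) := by
  -- Here r corrects m = 0 and m = 1, where log m = 0 and the quotient by it is 0 by convention; r
  -- vanishes for all other m.
  set r : ℕ → ℝ := fun m => |u m - u m / Real.log m * Real.log m| with hr
  set e : ℕ → ℝ := fun m => |u m / Real.log m - κ| + r m / Real.log 2 with he
  have hr0 : Tendsto r atTop (𝓝 0) := by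
    refine tendsto_const_nhds.congr' ?_
    filter_upwards [eventually_gt_atTop 1] with m hm
    have : Real.log m ≠ 0 := (Real.log_pos (by exact_mod_cast hm)).ne'
    simp [hr, this]
  have he0 : Tendsto e atTop (𝓝 0) := by
    have := (tendsto_sub_nhds_zero_iff.mpr h).abs.add (hr0.div_const (Real.log 2))
    simpa using this
  have hlim : Tendsto (fun N : ℕ => (N : ℝ)⁻¹ * ∑ m ∈ Finset.range N, e m +
      |κ| * ((Real.log N)⁻¹ + (N : ℝ)⁻¹)) atTop (𝓝 0) := by
    have h1 := tendsto_log_natCast.inv_tendsto_atTop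
    have h2 := (tendsto_natCast_atTop_atTop (R := ℝ)).inv_tendsto_atTop
    have := he0.cesaro.add ((h1.add h2).const_mul |κ|)
    simpa using this
  refine tendsto_of_tendsto_of_tendsto_of_le_of_le' tendsto_const_nhds hlim
    (Eventually.of_forall fun N => div_nonneg (Finset.sum_nonneg fun _ _ => abs_nonneg _)
      N.cast_nonneg) ?_
  filter_upwards [eventually_gt_atTop 1] with N hN
  have hN' : (0 : ℝ) < N := by exact_mod_cast (zero_lt_one.trans hN)
  have hL : 0 < Real.log N := Real.log_pos (by exact_mod_cast hN)
  have hL2 : Real.log 2 ≤ Real.log N := Real.log_le_log two_pos (by exact_mod_cast hN)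
  have hpt : ∀ m ∈ Finset.range N, |u m / Real.log N - κ| ≤
      e m + |κ| / Real.log N * (Real.log N - Real.log m) := by
    intro m hm
    have hm0 : 0 ≤ Real.log m := Real.log_natCast_nonneg m
    have hmN : Real.log m ≤ Real.log N := by
      rcases Nat.eq_zero_or_pos m with rfl | hpos
      · simpa using hL.le
      · exact Real.log_le_log (by exact_mod_cast hpos)
          (by exact_mod_cast (Finset.mem_range.mp hm).le)
    -- Three errors: the Cesàro-small deviation at m, the correction for m ≤ 1, and the cost of
    -- replacing log m by log N.
    have e1 : u m / Real.log N - κ = (u m / Real.log m - κ) * (Real.log m / Real.log N) +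
        (u m - u m / Real.log m * Real.log m) / Real.log N +
        -(κ / Real.log N * (Real.log N - Real.log m)) := by
      field_simp
      ring
    rw [e1]
    refine (abs_add_le _ _).trans (add_le_add ((abs_add_le _ _).trans (add_le_add ?_ ?_)) ?_)
    · rw [abs_mul, abs_of_nonneg (div_nonneg hm0 hL.le)]
      exact mul_le_of_le_one_right (abs_nonneg _) ((div_le_one hL).mpr hmN)
    · rw [abs_div, abs_of_pos hL]
      exact div_le_div_of_nonneg_left (abs_nonneg _) (Real.log_pos one_lt_two) hL2
    · rw [abs_neg, abs_mul, abs_div, abs_of_pos hL, abs_of_nonneg (sub_nonneg.mpr hmN)]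
  have hsum := Finset.sum_le_sum hpt
  rw [Finset.sum_add_distrib, ← Finset.mul_sum] at hsum
  have hlog := mul_le_mul_of_nonneg_left (sum_range_log_sub_le (zero_lt_one.trans hN))
    (div_nonneg (abs_nonneg κ) hL.le)
  rw [div_le_iff₀ hN']
  refine (hsum.trans (add_le_add_right hlog _)).trans (le_of_eq ?_)
  field_simp

theorem exists_windowSum_axisGreen_le :
    ∃ C : ℝ, 0 ≤ C ∧ ∀ N : ℕ, 1 < N → windowSum axisGreen N ≤ C * Real.log N := by
  obtain ⟨C, hC⟩ := tendsto_windowSum_axisGreen_div_log.bddAbove_range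
  refine ⟨max C 0, le_max_right _ _, fun N hN => ?_⟩
  rw [← div_le_iff₀ (Real.log_pos (by exact_mod_cast hN))]
  exact (hC ⟨N, rfl⟩).trans (le_max_left _ _)

theorem MeanTendsto.rodConv_axisGreen {h : ℕ → ℤ → ℝ} {η : ℝ} (H : MeanTendsto h η) :
    MeanTendsto (fun N z => _root_.rodConv axisGreen N (h N) z / Real.log N) (3 / Real.pi * η) := by
  obtain ⟨C, -, hC⟩ := exists_windowSum_axisGreen_le
  exact H.rodConv axisGreen_nonneg axisGreen_neg (tendsto_log_natCast.eventually_gt_atTop 0)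
    ((eventually_gt_atTop 1).mono hC)
    (tendsto_mean_of_tendsto_div_log tendsto_windowSum_axisGreen_div_log)

theorem windowSum_greenDefect_le (u : ℤ × ℤ) (m : ℕ) :
    windowSum (greenDefect u) m ≤ 3 / 2 * potentialKernel u :=
  sum_le_hasSum _ (fun z _ => greenDefect_nonneg u z) (hasSum_greenDefect u)

theorem tendsto_Icc_neg_natCast : Tendsto (fun m : ℕ => Finset.Icc (-m : ℤ) m) atTop atTop := by
  refine tendsto_atTop_finset_of_monotone
    (fun a b hab => Finset.Icc_subset_Icc (by omega) (by omega)) fun z => ⟨z.natAbs, ?_⟩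
  rw [Finset.mem_Icc]
  omega

theorem tendsto_windowSum_greenDefect (u : ℤ × ℤ) :
    Tendsto (windowSum (greenDefect u)) atTop (𝓝 (3 / 2 * potentialKernel u)) :=
  (hasSum_greenDefect u).comp tendsto_Icc_neg_natCast

theorem MeanTendsto.rodConv_greenDefect (u : ℤ × ℤ) {h : ℕ → ℤ → ℝ} {η : ℝ}
    (H : MeanTendsto h η) :
    MeanTendsto (fun N z => _root_.rodConv (greenDefect u) N (h N) z)
      (3 / 2 * potentialKernel u * η) := by
  have := H.rodConv (l := fun _ => 1) (C := 3 / 2 * potentialKernel u)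
    (κ := 3 / 2 * potentialKernel u) (greenDefect_nonneg u) (greenDefect_neg u)
    (Eventually.of_forall fun _ => one_pos)
    (Eventually.of_forall fun N => by simpa using windowSum_greenDefect_le u N) (by
      have h1 := (tendsto_sub_nhds_zero_iff.mpr (tendsto_windowSum_greenDefect u)).abs
      rw [abs_zero] at h1
      refine h1.cesaro.congr fun N => ?_
      simp only [div_one]
      rw [inv_mul_eq_div])
  simpa only [div_one] using this

end RodAverages

section RodIteration

/-! ### The iterates of `G V_N` -/

variable {Λ : Finset (ℤ × ℤ)} {W : ℤ × ℤ → ℝ}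

/-- The function `(G V_N)^n 1`. -/
noncomputable def rodIterate (W : ℤ × ℤ → ℝ) (N n : ℕ) : (ℤ × ℤ) × ℤ → ℝ :=
  (fun F : (ℤ × ℤ) × ℤ → ℝ => greenOp (fun x => rodPotential W N x * F x))^[n] (fun _ => 1)

/-- The rescaled `W`-weighted sum of `(G V_N)^n 1` over the fibre at height `z`. -/
noncomputable def rodCharge (Λ : Finset (ℤ × ℤ)) (W : ℤ × ℤ → ℝ) (N n : ℕ) (z : ℤ) : ℝ :=
  √(Real.log N) * ∑ y ∈ Λ, W y * rodIterate W N n (y, z)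

theorem tsum_mul_rodPotential (hW : ∀ y, y ∉ Λ → W y = 0) (N : ℕ) (Φ F : (ℤ × ℤ) × ℤ → ℝ) :
    ∑' x, Φ x * (rodPotential W N x * F x) = ∑ y ∈ Λ, ∑ z ∈ Finset.Icc (1 : ℤ) N,
      Φ (y, z) * (W y / √(Real.log N) * F (y, z)) := by
  rw [tsum_eq_sum (s := Λ ×ˢ Finset.Icc (1 : ℤ) N), Finset.sum_product]
  · refine Finset.sum_congr rfl fun y _ => Finset.sum_congr rfl fun z hz => ?_
    rw [rodPotential, if_pos (Finset.mem_Icc.mp hz)]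
  · rintro ⟨y, z⟩ hx
    rw [Finset.mem_product, not_and_or, Finset.mem_Icc] at hx
    have : rodPotential W N (y, z) = 0 := by
      rcases hx with hx | hx
      · simp [rodPotential, hW y hx]
      · exact if_neg hx
    rw [this, zero_mul, mul_zero]

theorem rodIterate_zero (W : ℤ × ℤ → ℝ) (N : ℕ) (x : (ℤ × ℤ) × ℤ) : rodIterate W N 0 x = 1 := rfl

theorem rodCharge_zero (hW0 : ∑ y ∈ Λ, W y = 0) (N : ℕ) (z : ℤ) : rodCharge Λ W N 0 z = 0 := by
  simp [rodCharge, rodIterate_zero, hW0]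

/-- The axis part of the Green function does not depend on y and sees the previous iterate only
through its charge, which carries the compensating √(log N). -/
theorem rodIterate_succ (hW : ∀ y, y ∉ Λ → W y = 0) {N : ℕ} (hN : 1 < N) (n : ℕ) (y : ℤ × ℤ)
    (z : ℤ) : rodIterate W N (n + 1) (y, z) =
      rodConv axisGreen N (rodCharge Λ W N n) z / Real.log N + -(√(Real.log N))⁻¹ *
        ∑ y' ∈ Λ, W y' *
          rodConv (greenDefect (y' - y)) N (fun z' => rodIterate W N n (y', z')) z := by
  have hL : 0 < Real.log N := Real.log_pos (by exact_mod_cast hN)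
  have hs : 0 < √(Real.log N) := Real.sqrt_pos.mpr hL
  have hss : √(Real.log N) * √(Real.log N) = Real.log N := Real.mul_self_sqrt hL.le
  have h1 : rodIterate W N (n + 1) (y, z) = ∑ y' ∈ Λ, ∑ z' ∈ Finset.Icc (1 : ℤ) N,
      green (y, z) (y', z') * (W y' / √(Real.log N) * rodIterate W N n (y', z')) := by
    rw [← tsum_mul_rodPotential hW N (green (y, z)), rodIterate, Function.iterate_succ_apply']
    rfl
  have h2 : rodConv axisGreen N (rodCharge Λ W N n) z / Real.log N =
      ∑ y' ∈ Λ, ∑ z' ∈ Finset.Icc (1 : ℤ) N,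
        axisGreen (z' - z) * (W y' / √(Real.log N) * rodIterate W N n (y', z')) := by
    rw [rodConv, Finset.sum_comm, Finset.sum_div]
    refine Finset.sum_congr rfl fun z' _ => ?_
    rw [rodCharge, Finset.mul_sum, Finset.mul_sum, Finset.sum_div]
    refine Finset.sum_congr rfl fun y' _ => ?_
    nth_rw 2 [← hss]
    field_simp
  rw [h1, h2, Finset.mul_sum, ← Finset.sum_add_distrib]
  refine Finset.sum_congr rfl fun y' _ => ?_
  rw [rodConv, Finset.mul_sum, Finset.mul_sum, ← Finset.sum_add_distrib]
  refine Finset.sum_congr rfl fun z' _ => ?_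
  rw [green_eq]
  ring

/-- Neutrality of W kills the axis part, which is constant in y. The defect part is of order 1/√(log
N), exactly undone by the scaling of the charge. -/
theorem rodCharge_succ (hW : ∀ y, y ∉ Λ → W y = 0) (hW0 : ∑ y ∈ Λ, W y = 0) {N : ℕ} (hN : 1 < N)
    (n : ℕ) (z : ℤ) : rodCharge Λ W N (n + 1) z = -∑ y ∈ Λ, ∑ y' ∈ Λ, W y * W y' *
      rodConv (greenDefect (y' - y)) N (fun z' => rodIterate W N n (y', z')) z := by
  have hs : √(Real.log N) ≠ 0 := (Real.sqrt_pos.mpr (Real.log_pos (by exact_mod_cast hN))).ne'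
  simp only [rodCharge, rodIterate_succ hW hN, mul_add, Finset.sum_add_distrib]
  rw [← Finset.sum_mul, hW0, zero_mul, mul_zero, zero_add, Finset.mul_sum, ← Finset.sum_neg_distrib]
  refine Finset.sum_congr rfl fun y _ => ?_
  rw [mul_left_comm, ← mul_assoc (√_), mul_neg, mul_inv_cancel₀ hs, neg_one_mul, mul_neg,
    Finset.mul_sum]
  simp only [mul_assoc]

theorem coeffA_succ (hW : ∀ y, y ∉ Λ → W y = 0) (α : ℝ) (N n : ℕ) :
    coeffA α W N (n + 1) =
      α * ((∑ z ∈ Finset.Icc (1 : ℤ) N, rodCharge Λ W N n z) / N) := by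
  have h1 : pairing (rodPotential W N) (rodIterate W N n) = ∑ y ∈ Λ, ∑ z ∈ Finset.Icc (1 : ℤ) N,
      W y / √(Real.log N) * rodIterate W N n (y, z) := by
    simpa only [one_mul, pairing] using tsum_mul_rodPotential hW N (fun _ => 1) (rodIterate W N n)
  have h2 : coeffA α W N (n + 1) =
      level α N * pairing (rodPotential W N) (rodIterate W N n) := rfl
  rw [h2, h1, level, Finset.sum_comm, mul_assoc, Finset.mul_sum, Finset.sum_div]
  congr 1
  refine Finset.sum_congr rfl fun z _ => ?_
  rw [rodCharge, Finset.mul_sum, Finset.mul_sum, Finset.sum_div]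
  refine Finset.sum_congr rfl fun y _ => ?_
  have e : Real.log N / √(Real.log N) = √(Real.log N) := Real.div_sqrt
  linear_combination W y * rodIterate W N n (y, z) / N * e

/-! ### Uniform bounds -/

theorem abs_rodConv_le {f : ℤ → ℝ} (h0 : ∀ z, 0 ≤ f z) (hf : ∀ z, f (-z) = f z) {N : ℕ} {M : ℝ}
    {h : ℤ → ℝ} (hM : 0 ≤ M) (hh : ∀ z ∈ Finset.Icc (1 : ℤ) N, |h z| ≤ M) {z : ℤ}
    (hz : z ∈ Finset.Icc (1 : ℤ) N) : |rodConv f N h z| ≤ windowSum f N * M := by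
  refine (Finset.abs_sum_le_sum_abs _ _).trans ?_
  calc ∑ z' ∈ Finset.Icc (1 : ℤ) N, |f (z' - z) * h z'|
      ≤ ∑ z' ∈ Finset.Icc (1 : ℤ) N, f (z' - z) * M := Finset.sum_le_sum fun z' hz' => by
        rw [abs_mul, abs_of_nonneg (h0 _)]
        exact mul_le_mul_of_nonneg_left (hh z' hz') (h0 _)
    _ ≤ windowSum f N * M := by
        rw [← Finset.sum_mul]
        exact mul_le_mul_of_nonneg_right (sum_rod_kernel_le h0 hf hz) hM

theorem potentialKernel_nonneg (u : ℤ × ℤ) : 0 ≤ potentialKernel u := by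
  have := (hasSum_greenDefect u).nonneg (greenDefect_nonneg u)
  linarith

theorem exists_rodIterate_bound (hW : ∀ y, y ∉ Λ → W y = 0) (hW0 : ∑ y ∈ Λ, W y = 0) :
    ∃ C : ℝ, 1 ≤ C ∧ ∀ N n : ℕ, 1 < N → ∀ z ∈ Finset.Icc (1 : ℤ) N,
      |rodCharge Λ W N n z| ≤ C ^ n ∧ ∀ y ∈ Λ, |rodIterate W N n (y, z)| ≤ C ^ n := by
  obtain ⟨C₁, hC₁0, hC₁⟩ := exists_windowSum_axisGreen_le
  set B : ℝ := ∑ y ∈ Λ, ∑ y' ∈ Λ, |W y'| * (3 / 2 * potentialKernel (y' - y)) with hB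
  set D : ℝ := ∑ y ∈ Λ, ∑ y' ∈ Λ, |W y| * |W y'| * (3 / 2 * potentialKernel (y' - y)) with hD
  have hp : ∀ u, 0 ≤ 3 / 2 * potentialKernel u := fun u =>
    mul_nonneg (by norm_num) (potentialKernel_nonneg u)
  have hinner : ∀ y, 0 ≤ ∑ y' ∈ Λ, |W y'| * (3 / 2 * potentialKernel (y' - y)) := fun y =>
    Finset.sum_nonneg fun y' _ => mul_nonneg (abs_nonneg _) (hp _)
  have hB0 : 0 ≤ B := Finset.sum_nonneg fun y _ => hinner y
  have hD0 : 0 ≤ D := Finset.sum_nonneg fun y _ => Finset.sum_nonneg fun y' _ =>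
    mul_nonneg (mul_nonneg (abs_nonneg _) (abs_nonneg _)) (hp _)
  have hs2 : 0 < √(Real.log 2) := Real.sqrt_pos.mpr (Real.log_pos one_lt_two)
  have hBs : 0 ≤ (√(Real.log 2))⁻¹ * B := mul_nonneg (inv_nonneg.mpr hs2.le) hB0
  -- D controls the charge recursion, C₁ and B the two parts of the iterate recursion, with 1/√(log
  -- N) ≤ 1/√(log 2). The 1 makes the powers of C nondecreasing.
  set C : ℝ := 1 + C₁ + (√(Real.log 2))⁻¹ * B + D with hC
  refine ⟨C, by linarith, fun N n hN => ?_⟩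
  have hCp : 0 ≤ C := by linarith
  have hL : 0 < Real.log N := Real.log_pos (by exact_mod_cast hN)
  have hL2 : (√(Real.log N))⁻¹ ≤ (√(Real.log 2))⁻¹ :=
    inv_anti₀ hs2 (Real.sqrt_le_sqrt (Real.log_le_log two_pos (by exact_mod_cast hN)))
  induction n with
  | zero => exact fun z _ => by simp [rodCharge_zero hW0, rodIterate_zero]
  | succ n ih =>
    intro z hz
    have hM : 0 ≤ C ^ n := pow_nonneg hCp n
    have hdef : ∀ y, ∀ y' ∈ Λ, |rodConv (greenDefect (y' - y)) N
        (fun z' => rodIterate W N n (y', z')) z| ≤ 3 / 2 * potentialKernel (y' - y) * C ^ n :=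
      fun y y' hy' => (abs_rodConv_le (greenDefect_nonneg _) (greenDefect_neg _) hM
        (fun z' hz' => (ih z' hz').2 y' hy') hz).trans
        (mul_le_mul_of_nonneg_right (windowSum_greenDefect_le _ N) hM)
    rw [pow_succ']
    constructor
    · rw [rodCharge_succ hW hW0 hN, abs_neg]
      have : |∑ y ∈ Λ, ∑ y' ∈ Λ, W y * W y' * rodConv (greenDefect (y' - y)) N
          (fun z' => rodIterate W N n (y', z')) z| ≤ D * C ^ n := by
        rw [hD, Finset.sum_mul]
        refine (Finset.abs_sum_le_sum_abs _ _).trans (Finset.sum_le_sum fun y _ => ?_)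
        rw [Finset.sum_mul]
        refine (Finset.abs_sum_le_sum_abs _ _).trans (Finset.sum_le_sum fun y' hy' => ?_)
        rw [abs_mul, abs_mul, mul_assoc (|W y| * |W y'|)]
        exact mul_le_mul_of_nonneg_left (hdef y y' hy')
          (mul_nonneg (abs_nonneg _) (abs_nonneg _))
      exact this.trans (mul_le_mul_of_nonneg_right (by linarith) hM)
    · intro y hy
      rw [rodIterate_succ hW hN]
      have h1 : |rodConv axisGreen N (rodCharge Λ W N n) z / Real.log N| ≤ C₁ * C ^ n := by
        rw [abs_div, abs_of_pos hL, div_le_iff₀ hL]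
        refine (abs_rodConv_le axisGreen_nonneg axisGreen_neg hM
          (fun z' hz' => (ih z' hz').1) hz).trans ?_
        refine (mul_le_mul_of_nonneg_right (hC₁ N hN) hM).trans (le_of_eq ?_)
        ring
      have h2 : |∑ y' ∈ Λ, W y' * rodConv (greenDefect (y' - y)) N
          (fun z' => rodIterate W N n (y', z')) z| ≤ B * C ^ n := by
        have h3 : ∑ y' ∈ Λ, |W y'| * (3 / 2 * potentialKernel (y' - y)) ≤ B :=
          Finset.single_le_sum (f := fun y => ∑ y' ∈ Λ, |W y'| *
            (3 / 2 * potentialKernel (y' - y))) (fun y _ => hinner y) hy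
        refine le_trans ?_ (mul_le_mul_of_nonneg_right h3 hM)
        rw [Finset.sum_mul]
        refine (Finset.abs_sum_le_sum_abs _ _).trans (Finset.sum_le_sum fun y' hy' => ?_)
        rw [abs_mul, mul_assoc]
        exact mul_le_mul_of_nonneg_left (hdef y y' hy') (abs_nonneg _)
      have h4 : |-(√(Real.log N))⁻¹ * ∑ y' ∈ Λ, W y' * rodConv (greenDefect (y' - y)) N
          (fun z' => rodIterate W N n (y', z')) z| ≤ (√(Real.log 2))⁻¹ * (B * C ^ n) := by
        rw [abs_mul, abs_neg, abs_of_nonneg (inv_nonneg.mpr (Real.sqrt_nonneg _))]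
        exact mul_le_mul hL2 h2 (abs_nonneg _) (inv_nonneg.mpr hs2.le)
      refine (abs_add_le _ _).trans ((add_le_add h1 h4).trans ?_)
      have : C₁ * C ^ n + (√(Real.log 2))⁻¹ * (B * C ^ n)
          = (C₁ + (√(Real.log 2))⁻¹ * B) * C ^ n := by ring
      rw [this]
      exact mul_le_mul_of_nonneg_right (by linarith) hM

theorem exists_coeffA_bound (hW : ∀ y, y ∉ Λ → W y = 0) (hW0 : ∑ y ∈ Λ, W y = 0) :
    ∃ c₀ : ℝ, 0 < c₀ ∧ ∀ α : ℝ, 0 < α → ∀ n N : ℕ, 1 ≤ n → 1 < N →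
      |coeffA α W N n| ≤ α * c₀ ^ n := by
  obtain ⟨C, hC1, hC⟩ := exists_rodIterate_bound hW hW0
  refine ⟨C, by linarith, fun α hα n N hn hN => ?_⟩
  obtain ⟨n, rfl⟩ := Nat.exists_eq_add_of_le' hn
  have hN' : (0 : ℝ) < N := by exact_mod_cast zero_lt_one.trans hN
  rw [coeffA_succ hW, abs_mul, abs_of_pos hα, abs_div, abs_of_pos hN']
  refine mul_le_mul_of_nonneg_left ?_ hα.le
  rw [div_le_iff₀ hN']
  have := Finset.sum_le_card_nsmul (Finset.Icc (1 : ℤ) N) (fun z => |rodCharge Λ W N n z|) _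
    fun z hz => (hC N n hN z hz).1
  rw [Int.card_Icc, nsmul_eq_mul, show (N + 1 - 1 : ℤ).toNat = N by omega, mul_comm] at this
  refine (Finset.abs_sum_le_sum_abs _ _).trans (this.trans ?_)
  exact mul_le_mul_of_nonneg_right (pow_le_pow_right₀ hC1 (Nat.le_succ n)) hN'.le

/-! ### Limits -/

/-- The limits in mean of the iterates and of their charges. -/
noncomputable def limitPair (E : ℝ) : ℕ → ℝ × ℝ
  | 0 => (1, 0)
  | n + 1 => (3 / Real.pi * (limitPair E n).2, E / 2 * (limitPair E n).1)

/-- Iterates and charges converge jointly, since each recursion feeds on the other. The limit of the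
iterates is the same for every y in Λ, which lets 𝓔(W) factor out of the charge. -/
theorem meanTendsto_rod (hW : ∀ y, y ∉ Λ → W y = 0) (hW0 : ∑ y ∈ Λ, W y = 0) (n : ℕ) :
    (∀ y ∈ Λ, MeanTendsto (fun N z => rodIterate W N n (y, z)) (limitPair (energy Λ W) n).1) ∧
      MeanTendsto (fun N z => rodCharge Λ W N n z) (limitPair (energy Λ W) n).2 := by
  induction n with
  | zero =>
    refine ⟨fun y _ => MeanTendsto.const 1, ?_⟩
    simp only [rodCharge_zero hW0]
    exact MeanTendsto.const 0
  | succ n ih =>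
    obtain ⟨C, hC1, hC⟩ := exists_rodIterate_bound hW hW0
    set φ := (limitPair (energy Λ W) n).1
    have hconv : ∀ y, ∀ y' ∈ Λ, MeanTendsto (fun N z => rodConv (greenDefect (y' - y)) N
        (fun z' => rodIterate W N n (y', z')) z) (3 / 2 * potentialKernel (y' - y) * φ) :=
      fun y y' hy' => (ih.1 y' hy').rodConv_greenDefect (y' - y)
    constructor
    · intro y hy
      have h1 := ih.2.rodConv_axisGreen
      -- The defect part vanishes uniformly on the rod: the a priori bound on the iterates is
      -- independent of N and the prefactor tends to 0.
      have h2 : MeanTendsto (fun N z => -(√(Real.log N))⁻¹ * ∑ y' ∈ Λ, W y' *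
          rodConv (greenDefect (y' - y)) N (fun z' => rodIterate W N n (y', z')) z) 0 := by
        have hlim : Tendsto (fun N : ℕ => (√(Real.log N))⁻¹ *
            (∑ y' ∈ Λ, |W y'| * (3 / 2 * potentialKernel (y' - y) * C ^ n))) atTop (𝓝 0) := by
          have := (Real.tendsto_sqrt_atTop.comp tendsto_log_natCast).inv_tendsto_atTop
          simpa using this.mul_const _
        refine MeanTendsto.of_pointwise hlim ?_
        filter_upwards [eventually_gt_atTop 1] with N hN z hz
        rw [sub_zero, abs_mul, abs_neg, abs_of_nonneg (inv_nonneg.mpr (Real.sqrt_nonneg _))]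
        refine mul_le_mul_of_nonneg_left ?_ (inv_nonneg.mpr (Real.sqrt_nonneg _))
        refine (Finset.abs_sum_le_sum_abs _ _).trans (Finset.sum_le_sum fun y' hy' => ?_)
        rw [abs_mul]
        refine mul_le_mul_of_nonneg_left ?_ (abs_nonneg _)
        have hM : 0 ≤ C ^ n := by positivity
        exact (abs_rodConv_le (greenDefect_nonneg _) (greenDefect_neg _) hM
          (fun z' hz' => (hC N n hN z' hz').2 y' hy') hz).trans
          (mul_le_mul_of_nonneg_right (windowSum_greenDefect_le _ N) hM)
      have h3 := h1.add h2
      rw [add_zero] at h3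
      refine h3.congr ?_
      filter_upwards [eventually_gt_atTop 1] with N hN z _ using (rodIterate_succ hW hN n y z).symm
    · have h1 := (MeanTendsto.sum Λ fun y _ => MeanTendsto.sum Λ fun y' hy' =>
        (hconv y y' hy').const_mul (W y * W y')).const_mul (-1)
      have e : -1 * ∑ y ∈ Λ, ∑ y' ∈ Λ, W y * W y' * (3 / 2 * potentialKernel (y' - y) * φ)
          = (limitPair (energy Λ W) (n + 1)).2 := by
        have h2 : ∀ y y', W y * W y' * (3 / 2 * potentialKernel (y' - y) * φ)
            = 3 / 2 * φ * (W y * W y' * potentialKernel (y' - y)) := fun y y' => by ring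
        change _ = energy Λ W / 2 * φ
        rw [energy]
        simp only [h2, ← Finset.mul_sum]
        ring
      rw [e] at h1
      refine h1.congr ?_
      filter_upwards [eventually_gt_atTop 1] with N hN z _
      rw [rodCharge_succ hW hW0 hN, neg_one_mul]

theorem tendsto_coeffA (hW : ∀ y, y ∉ Λ → W y = 0) (hW0 : ∑ y ∈ Λ, W y = 0) (α : ℝ) (n : ℕ) :
    Tendsto (fun N : ℕ => coeffA α W N (n + 1)) atTop
      (𝓝 (α * (limitPair (energy Λ W) n).2)) := by
  simp only [coeffA_succ hW]
  exact (meanTendsto_rod hW hW0 n).2.tendsto_mean.const_mul α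

/-- The recursion exchanges the two components, so starting from (1, 0) the charge limit vanishes at
even indices; two steps multiply by (3/π)(E/2). -/
theorem limitPair_two_mul (E : ℝ) (k : ℕ) :
    limitPair E (2 * k) = ((3 / (2 * Real.pi) * E) ^ k, 0) := by
  induction k with
  | zero => simp [limitPair]
  | succ k ih =>
    rw [show 2 * (k + 1) = 2 * k + 1 + 1 by ring]
    simp only [limitPair, ih, mul_zero, Prod.mk.injEq, and_true]
    rw [pow_succ']
    field_simp

end RodIteration

theorem theorem4p1 :
    -- the Green function and the potential kernel are given by convergent series and limits
    (∀ x x' : (ℤ × ℤ) × ℤ, Summable (fun n : ℕ => walkProb steps3 n x x')) ∧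
    (∀ y : ℤ × ℤ, Tendsto (potentialSum y) atTop (𝓝 (potentialKernel y))) ∧
    ∀ (Λ : Finset (ℤ × ℤ)) (_ : (0 : ℤ × ℤ) ∈ Λ) (W : ℤ × ℤ → ℝ)
      (_ : ∀ y, y ∉ Λ → W y = 0) (_ : ∑ y ∈ Λ, W y = 0),
      ∃ c₀ : ℝ, 0 < c₀ ∧ ∀ α : ℝ, 0 < α →
        (∀ n N : ℕ, 1 ≤ n → 1 < N → |coeffA α W N n| ≤ α * c₀ ^ n) ∧
        (∀ k : ℕ, Tendsto (fun N : ℕ => coeffA α W N (2 * k + 1)) atTop (𝓝 0)) ∧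
        (∀ k : ℕ, 1 ≤ k →
          Tendsto (fun N : ℕ => coeffA α W N (2 * k)) atTop
            (𝓝 (α / 2 * energy Λ W * (3 / (2 * Real.pi) * energy Λ W) ^ (k - 1)))) := by
  refine ⟨fun x x' => (hasSum_walkProb_steps3 x x').summable, tendsto_potentialSum,
    fun Λ _ W hW hW0 => ?_⟩
  obtain ⟨c₀, hc₀, hbound⟩ := exists_coeffA_bound hW hW0
  refine ⟨c₀, hc₀, fun α hα => ⟨hbound α hα, fun k => ?_, fun k hk => ?_⟩⟩
  -- The coefficient of order n is governed by the charge of the iterate n - 1, so odd orders see an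
  -- even index, where the limit charge is 0.
  · simpa [limitPair_two_mul] using tendsto_coeffA hW hW0 α (2 * k)
  · obtain ⟨k, rfl⟩ := Nat.exists_eq_add_of_le' hk
    have := tendsto_coeffA hW hW0 α (2 * k + 1)
    simp only [limitPair, limitPair_two_mul] at this
    rw [show 2 * (k + 1) = 2 * k + 1 + 1 by ring, Nat.add_sub_cancel]
    convert this using 2
    ring
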